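/- All algebras are over $\mathbb{C}$, associative and unital, and the co-products, co-units and co-actions below are algebra homomorphisms defined by the given values on generators, except for the linear map $\delta^\alpha$. **Series side.** Let $\mathbb{C}(G^{\mathrm{dif}})=\mathbb{C}[a_1,a_2,\dots]$ be the polynomial ring, with $a_0:=1$, $A(x)=\sum_{n\ge0}a_nx^{n+1}$, and let $\Delta^{\mathrm{dif}}a_n$ be the coefficient of $x^{n+1}$ in $\sum_{k\ge0}a_k\otimes A(x)^{k+1}$, $\varepsilon(a_n)=0$ for $n\ge1$. Let $\mathcal{H}^{\mathrm{inv}}=\mathbb{C}\langle b_1,b_2,\dots\rangle$ be the free algebra, with $b_0:=1$, $\Delta^{\mathrm{inv}}b_n=\sum_{k=0}^n b_k\otimes b_{n-k}$, $\varepsilon(b_n)=0$ for $n\ge1$. Let $\delta^{\mathrm{dif}}:\mathcal{H}^{\mathrm{inv}}\to\mathcal{H}^{\mathrm{inv}}\otimes\mathbb{C}(G^{\mathrm{dif}})$ be such that $\delta^{\mathrm{dif}}b_n$ is the coefficient of $x^n$ in $\sum_{k\ge0}b_k\otimes A(x)^k$. **Tree side.** Let $Y_\infty$ be the set of rooted planar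 binary trees, $|$ the root tree, $|t|$ the number of internal vertices of $t$, $r\vee s$ the grafting of $r$ (left) and $s$ (right) on a new root, $V(s)=|\vee s$, and $t/s$ the grafting of the root of $t$ on the left-most leaf of $s$. Let $\widetilde{\mathcal H}^\alpha$ be the vector space spanned by $Y_\infty$, with product $/$ and unit $|$. Define linear maps $\Delta^\alpha,\delta^\alpha:\widetilde{\mathcal H}^\alpha\to\widetilde{\mathcal H}^\alpha\otimes\widetilde{\mathcal H}^\alpha$ by $\Delta^\alpha|=\delta^\alpha|=|\otimes|$ and $$\delta^\alpha V(s)=(V\otimes\mathrm{Id})\delta^\alpha(s),\quad \Delta^\alpha V(s)=|\otimes V(s)+\delta^\alpha V(s),\quad \Delta^\alpha(r\vee s)=\Delta^\alpha r/\Delta^\alpha V(s),\quad \delta^\alpha(r\vee s)=\Delta^\alpha r/\delta^\alpha V(s).$$ Let $\mathcal H^\alpha=\mathbb{C}[V(s),\,s\in Y_\infty]$ be the Abelianisation of $\widetilde{\mathcal H}^\alpha$, with the co-product induced by $\Delta^\alpha$ and the co-unit vanishing on all trees $t\ne|$. Let $\mathcal H^e=\mathbb{C}\langle Y_\infty\rangle/(|-1)$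 be the free algebra on trees with $|$ identified with $1$; its co-product is given on trees by $\Delta^p_e|=|\otimes|$, $\Delta^p_e(r\vee s)=|\otimes(r\vee s)+\sum(r\vee s_{(1)})\otimes s_{(2)}$, where $\Delta^p_e(s)=\sum s_{(1)}\otimes s_{(2)}$ is a sum of tensors of trees; its co-unit vanishes on all trees $t\ne|$. Let $\delta^e:\mathcal H^e\to\mathcal H^e\otimes\mathcal H^\alpha$ be the multiplicative extension of $\delta^\alpha$ (on a tree $t$, $\delta^e(t)$ is $\delta^\alpha(t)$ with its left factors read as elements of $\mathcal H^e$ and its right factors as elements of $\mathcal H^\alpha$). Put $t_n=\sum_{|t|=n}t$. **Semi-direct co-product.** For a commutative algebra $H$ with co-product $\Delta_H$ and co-unit $\varepsilon_H$, an algebra $B$ with co-product $\Delta_B$ and co-unit $\varepsilon_B$, and $\delta:B\to B\otimes H$, let $H\ltimes B$ be the algebra $H\otimes B$ with $\Delta(a\otimes b)=\Delta_H(a)\,[(\delta\otimes\mathrm{Id})\Delta_B(b)]$, where $b'\otimes h\otimes b''\in B\otimes H\otimes B$ is read as $(1\otimes b')\otimes(h\otimes b'')$ and $a_1\otimes a_2\in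 H\otimes H$ as $(a_1\otimes1)\otimes(a_2\otimes1)$, and with co-unit $\varepsilon_H\otimes\varepsilon_B$. **Corollary 4.3.** There are injective algebra homomorphisms $\Omega:\mathbb{C}(G^{\mathrm{dif}})\to\mathcal H^\alpha$, $a_n\mapsto t_n$, and $j:\mathcal H^{\mathrm{inv}}\to\mathcal H^e$, $b_n\mapsto t_n$ $(n\ge0)$, which respect the co-products and the co-units and are compatible with the co-actions: $\delta^e\circ j=(j\otimes\Omega)\circ\delta^{\mathrm{dif}}$. Moreover $\mathbb{C}(G^{\mathrm{dif}})\ltimes\mathcal H^{\mathrm{inv}}$ (with $\delta^{\mathrm{dif}}$) and the QED renormalization Hopf algebra $\mathcal H^\alpha\ltimes\mathcal H^e$ (with $\delta^e$) are Hopf algebras, and the map $a\otimes b\mapsto\Omega(a)\otimes j(b)$ is an injective homomorphism of bi-algebras from the first to the second which commutes with the antipodes. Thus $\mathbb{C}(G^{\mathrm{dif}})\ltimes\mathcal H^{\mathrm{inv}}$ is a Hopf sub-algebra of $\mathcal H^\alpha\ltimes\mathcal H^e$. -/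

import Mathlib

open scoped TensorProduct
open Function

noncomputable section

namespace QEDHopf

/-! ### Hopf algebras presented by a co-product and a co-unit -/

/-- The algebra homomorphisms `Δ` and `ε` make the unital associative algebra `A` a Hopf algebra. -/
structure IsHopf {A : Type} [Semiring A] [Algebra ℂ A]
    (Δ : A →ₐ[ℂ] A ⊗[ℂ] A) (ε : A →ₐ[ℂ] ℂ) : Prop where
  coassoc : (Algebra.TensorProduct.assoc ℂ ℂ ℂ A A A).toAlgHom.comp
      ((Algebra.TensorProduct.map Δ (AlgHom.id ℂ A)).comp Δ) =
    (Algebra.TensorProduct.map (AlgHom.id ℂ A) Δ).comp Δ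
  rTensor : (Algebra.TensorProduct.map ε (AlgHom.id ℂ A)).comp Δ =
    (Algebra.TensorProduct.lid ℂ A).symm
  lTensor : (Algebra.TensorProduct.map (AlgHom.id ℂ A) ε).comp Δ =
    (Algebra.TensorProduct.rid ℂ ℂ A).symm
  exists_antipode : ∃ S : A →ₗ[ℂ] A,
    LinearMap.mul' ℂ A ∘ₗ S.rTensor A ∘ₗ Δ.toLinearMap = Algebra.linearMap ℂ A ∘ₗ ε.toLinearMap ∧
    LinearMap.mul' ℂ A ∘ₗ S.lTensor A ∘ₗ Δ.toLinearMap = Algebra.linearMap ℂ A ∘ₗ ε.toLinearMap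

/-- The Hopf algebra with underlying algebra `A`, co-product `Δ` and co-unit `ε` (its antipode is
uniquely determined by these). -/
@[reducible] def IsHopf.hopfAlgebra {A : Type} [Semiring A] [Algebra ℂ A]
    {Δ : A →ₐ[ℂ] A ⊗[ℂ] A} {ε : A →ₐ[ℂ] ℂ} (h : IsHopf Δ ε) : HopfAlgebra ℂ A :=
  { Bialgebra.ofAlgHom Δ ε h.coassoc h.rTensor h.lTensor with
    antipode := h.exists_antipode.choose
    mul_antipode_rTensor_comul := h.exists_antipode.choose_spec.1
    mul_antipode_lTensor_comul := h.exists_antipode.choose_spec.2 }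

/-! ### Semi-direct (smash) co-products

Here `H` is commutative with co-product `ΔH`, `B` has co-product `ΔB`, and `δ : B → B ⊗ H` is a
right co-action by an algebra homomorphism. -/

section Smash

variable {H B : Type} [CommRing H] [Algebra ℂ H] [Semiring B] [Algebra ℂ B]

/-- `a ↦ ∑ (a₁ ⊗ 1) ⊗ (a₂ ⊗ 1)`, where `ΔH a = ∑ a₁ ⊗ a₂`. -/
def smashLeft (ΔH : H →ₐ[ℂ] H ⊗[ℂ] H) : H →ₐ[ℂ] (H ⊗[ℂ] B) ⊗[ℂ] (H ⊗[ℂ] B) :=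
  (Algebra.TensorProduct.map Algebra.TensorProduct.includeLeft
    Algebra.TensorProduct.includeLeft).comp ΔH

/-- `b ↦ (δ ⊗ Id) (ΔB b)`, whose value in `B ⊗ H ⊗ B` is read in `(H ⊗ B) ⊗ (H ⊗ B)` through
`b' ⊗ h ⊗ b'' ↦ (1 ⊗ b') ⊗ (h ⊗ b'')`. -/
def smashRight (ΔB : B →ₐ[ℂ] B ⊗[ℂ] B) (δ : B →ₐ[ℂ] B ⊗[ℂ] H) :
    B →ₐ[ℂ] (H ⊗[ℂ] B) ⊗[ℂ] (H ⊗[ℂ] B) :=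
  ((Algebra.TensorProduct.map Algebra.TensorProduct.includeRight (AlgHom.id ℂ (H ⊗[ℂ] B))).comp
    (Algebra.TensorProduct.assoc ℂ ℂ ℂ B H B).toAlgHom).comp
    ((Algebra.TensorProduct.map δ (AlgHom.id ℂ B)).comp ΔB)

theorem smash_commute (ΔH : H →ₐ[ℂ] H ⊗[ℂ] H) (ΔB : B →ₐ[ℂ] B ⊗[ℂ] B) (δ : B →ₐ[ℂ] B ⊗[ℂ] H)
    (a : H) (b : B) : Commute (smashLeft (B := B) ΔH a) (smashRight ΔB δ b) := by
  have key : ∀ (x : H ⊗[ℂ] H) (y : (H ⊗[ℂ] B) ⊗[ℂ] (H ⊗[ℂ] B)),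
      Commute (Algebra.TensorProduct.map (Algebra.TensorProduct.includeLeft : H →ₐ[ℂ] H ⊗[ℂ] B)
        (Algebra.TensorProduct.includeLeft : H →ₐ[ℂ] H ⊗[ℂ] B) x) y := by
    have h1 : ∀ (u : H) (v : H ⊗[ℂ] B), Commute (u ⊗ₜ[ℂ] (1 : B)) v := by
      intro u v
      induction v with
      | zero => exact Commute.zero_right _
      | tmul p q => simp [commute_iff_eq, mul_comm u p]
      | add p q hp hq => exact hp.add_right hq
    intro x y
    induction x with
    | zero => simp
    | add p q hp hq => rw [map_add]; exact hp.add_left hq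
    | tmul u v =>
      induction y with
      | zero => exact Commute.zero_right _
      | tmul p q => simp [commute_iff_eq, (h1 u p).eq, (h1 v q).eq]
      | add p q hp hq => exact hp.add_right hq
  exact key _ _

/-- The co-product of the semi-direct co-product `H ⋉ B`, whose underlying algebra is `H ⊗ B`:
`Δ (a ⊗ b) = ΔH a [(δ ⊗ Id) (ΔB b)]`. -/
def smashComul (ΔH : H →ₐ[ℂ] H ⊗[ℂ] H) (ΔB : B →ₐ[ℂ] B ⊗[ℂ] B) (δ : B →ₐ[ℂ] B ⊗[ℂ] H) :
    H ⊗[ℂ] B →ₐ[ℂ] (H ⊗[ℂ] B) ⊗[ℂ] (H ⊗[ℂ] B) :=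
  Algebra.TensorProduct.lift (smashLeft ΔH) (smashRight ΔB δ) (smash_commute ΔH ΔB δ)

/-- The co-unit `a ⊗ b ↦ εH a * εB b` of `H ⋉ B`. -/
def smashCounit (εH : H →ₐ[ℂ] ℂ) (εB : B →ₐ[ℂ] ℂ) : H ⊗[ℂ] B →ₐ[ℂ] ℂ :=
  Algebra.TensorProduct.lift εH εB (fun _ _ => mul_comm _ _)

end Smash

/-! ### The co-ordinate ring of formal diffeomorphisms -/

/-- `ℂ(G^dif) = ℂ[a₁, a₂, …]`; the variable with index `n` is `a_{n+1}`. -/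
abbrev CGdif : Type := MvPolynomial ℕ ℂ

/-- The co-ordinate function `a_n`, with `a_0 = 1`. -/
def a : ℕ → CGdif
  | 0 => 1
  | n + 1 => MvPolynomial.X n

/-- The generating series `A(x) = ∑ a_n x^{n+1}`. -/
def seriesA : PowerSeries CGdif := PowerSeries.X * PowerSeries.mk a

/-- The co-product dual to composition of series: `Δ a_n` is the coefficient of `x^{n+1}` in
`Δ A(x) = ⟨z⁻¹⟩ A(z) ⊗ 1/(z - A(x)) = ∑_k a_k ⊗ A(x)^{k+1}`. -/
def difComul : CGdif →ₐ[ℂ] CGdif ⊗[ℂ] CGdif :=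
  MvPolynomial.aeval fun n => ∑ k ∈ Finset.range (n + 2),
    a k ⊗ₜ[ℂ] PowerSeries.coeff (n + 2) (seriesA ^ (k + 1))

/-- The co-unit: `a_n ↦ 0` for `n ≥ 1`. -/
def difCounit : CGdif →ₐ[ℂ] ℂ := MvPolynomial.aeval fun _ => 0

/-! ### The non-commutative Hopf algebra of invertible series -/

/-- `H^inv = ℂ⟨b₁, b₂, …⟩`; the generator with index `n` is `b_{n+1}`. -/
abbrev Hinv : Type := FreeAlgebra ℂ ℕ

/-- The generator `b_n`, with `b_0 = 1`. -/
def b : ℕ → Hinv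
  | 0 => 1
  | n + 1 => FreeAlgebra.ι ℂ n

/-- `Δ b_n = ∑_{k=0}^n b_k ⊗ b_{n-k}`. -/
def invComul : Hinv →ₐ[ℂ] Hinv ⊗[ℂ] Hinv :=
  FreeAlgebra.lift ℂ fun n => ∑ k ∈ Finset.range (n + 2), b k ⊗ₜ[ℂ] b (n + 1 - k)

/-- The co-unit: `b_n ↦ 0` for `n ≥ 1`. -/
def invCounit : Hinv →ₐ[ℂ] ℂ := FreeAlgebra.lift ℂ fun _ => 0

/-- The co-action of `ℂ(G^dif)` on `H^inv`: `δ b_n` is the coefficient of `x^n` in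
`δ B(x) = ⟨z⁻¹⟩ B(z) ⊗ 1/(z - A(x)) = ∑_k b_k ⊗ A(x)^k`. -/
def difCoaction : Hinv →ₐ[ℂ] Hinv ⊗[ℂ] CGdif :=
  FreeAlgebra.lift ℂ fun n => ∑ k ∈ Finset.range (n + 2),
    b k ⊗ₜ[ℂ] PowerSeries.coeff (n + 1) (seriesA ^ k)

/-! ### Planar binary trees -/

/-- Rooted planar binary trees, described by their internal vertices: `nil` is the root tree `|`
and `node () r s` is `r ∨ s`, the grafting of `r` (left) and `s` (right) on a new root. -/
abbrev PBT : Type := BinaryTree Unit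

/-- The tree `t` over `s`: the root of `t` is grafted on the left-most leaf of `s`. -/
def overProd (t : PBT) : PBT → PBT
  | .nil => t
  | .node _ r s => .node () (overProd t r) s

/-- Trees form a monoid under the over product, with unit the root tree. -/
instance overMonoid : Monoid PBT where
  mul := overProd
  one := .nil
  mul_assoc t u v := by
    change overProd (overProd t u) v = overProd t (overProd u v)
    induction v with
    | nil => rfl
    | node _ r s hr _ => simp [overProd, hr]
  one_mul t := by
    change overProd .nil t = t
    induction t with
    | nil => rfl
    | node _ r s hr _ => simp [overProd, hr]
  mul_one _ := rfl

/-- `V(t) = | ∨ t`. -/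
def V (t : PBT) : PBT := .node () .nil t

/-- The vector space spanned by all trees, with the over product. -/
abbrev TreeAlg : Type := MonoidAlgebra ℂ PBT

/-- A tree as a basis element. -/
def tree (t : PBT) : TreeAlg := MonoidAlgebra.of ℂ PBT t

/-- The linear map determined by its values on the basis of trees. -/
def linearExt {M : Type} [AddCommMonoid M] [Module ℂ M] (f : PBT → M) : TreeAlg →ₗ[ℂ] M :=
  (MonoidAlgebra.basis PBT ℂ).constr ℂ f

/-- `t_n`, the sum of all trees with `n` internal vertices. -/
def treeSum (n : ℕ) : TreeAlg := ∑ t ∈ BinaryTree.treesOfNumNodesEq n, tree t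

/-- The linear map `V ⊗ Id`. -/
def VTensorId : TreeAlg ⊗[ℂ] TreeAlg →ₗ[ℂ] TreeAlg ⊗[ℂ] TreeAlg :=
  TensorProduct.map (linearExt fun t => tree (V t)) LinearMap.id

/-- The pair `(Δ^α t, δ^α t)` for a tree `t`, by simultaneous recursion; see the recursive formulae
proved below for its two components. -/
def treeMaps : PBT → (TreeAlg ⊗[ℂ] TreeAlg) × (TreeAlg ⊗[ℂ] TreeAlg)
  | .nil => (tree .nil ⊗ₜ[ℂ] tree .nil, tree .nil ⊗ₜ[ℂ] tree .nil)
  | .node _ r s =>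
    ((treeMaps r).1 * (tree .nil ⊗ₜ[ℂ] tree (V s) + VTensorId (treeMaps s).2),
      (treeMaps r).1 * VTensorId (treeMaps s).2)

/-- The co-product `Δ^α` on trees. -/
def treeComul (t : PBT) : TreeAlg ⊗[ℂ] TreeAlg := (treeMaps t).1

/-- The co-action `δ^α` on trees. -/
def treeCoaction (t : PBT) : TreeAlg ⊗[ℂ] TreeAlg := (treeMaps t).2

theorem treeComul_nil : treeComul .nil = tree .nil ⊗ₜ[ℂ] tree .nil := rfl

theorem treeCoaction_nil : treeCoaction .nil = tree .nil ⊗ₜ[ℂ] tree .nil := rfl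

theorem tree_nil_tmul : tree .nil ⊗ₜ[ℂ] tree .nil = (1 : TreeAlg ⊗[ℂ] TreeAlg) := rfl

/-- `δ V(s) = (V ⊗ Id) δ s`. -/
theorem treeCoaction_V (s : PBT) : treeCoaction (V s) = VTensorId (treeCoaction s) := by
  rw [← one_mul (VTensorId _), ← tree_nil_tmul]; rfl

/-- `Δ V(s) = | ⊗ V(s) + δ V(s)`. -/
theorem treeComul_V (s : PBT) :
    treeComul (V s) = tree .nil ⊗ₜ[ℂ] tree (V s) + treeCoaction (V s) := by
  rw [treeCoaction_V, ← one_mul (_ + _), ← tree_nil_tmul]; rfl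

/-- `Δ (r ∨ s) = Δ r / Δ V(s)`. -/
theorem treeComul_node (r s : PBT) :
    treeComul (.node () r s) = treeComul r * treeComul (V s) := by
  rw [treeComul_V, treeCoaction_V]; rfl

/-- `δ (r ∨ s) = Δ r / δ V(s)`. -/
theorem treeCoaction_node (r s : PBT) :
    treeCoaction (.node () r s) = treeComul r * treeCoaction (V s) := by
  rw [treeCoaction_V]; rfl

/-- The co-product on trees dual to the under product: `Δ | = | ⊗ |` and
`Δ (r ∨ s) = | ⊗ (r ∨ s) + ∑ (r ∨ s₁) ⊗ s₂`, where `Δ s = ∑ s₁ ⊗ s₂`. -/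
def underComul : PBT → TreeAlg ⊗[ℂ] TreeAlg
  | .nil => tree .nil ⊗ₜ[ℂ] tree .nil
  | .node _ r s => tree .nil ⊗ₜ[ℂ] tree (.node () r s) +
      TensorProduct.map (linearExt fun t => tree (.node () r t)) LinearMap.id (underComul s)

/-! ### The charge renormalization Hopf algebra -/

/-- `H^α`, the Abelianisation of the algebra of trees with the over product. The latter is free on
the trees `V(s)`, so `H^α` is the polynomial ring in variables indexed by `s`, the variable with
index `s` being the class of `V(s)`. -/
abbrev Halpha : Type := MvPolynomial PBT ℂ

/-- The class of a tree in `H^α`, from the decomposition `r ∨ s = r / V(s)`. -/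
def treeClass : PBT → Halpha
  | .nil => 1
  | .node _ r s => treeClass r * MvPolynomial.X s

theorem treeClass_over (t s : PBT) : treeClass (overProd t s) = treeClass t * treeClass s := by
  induction s with
  | nil => simp [overProd, treeClass]
  | node _ r s hr _ => simp [overProd, treeClass, hr, mul_assoc]

/-- The projection of the algebra of trees onto its Abelianisation. -/
def toHalpha : TreeAlg →ₐ[ℂ] Halpha :=
  MonoidAlgebra.lift ℂ Halpha PBT
    { toFun := treeClass, map_one' := rfl, map_mul' := treeClass_over }

/-- The co-product of `H^α`, induced by the one on trees. -/
def alphaComul : Halpha →ₐ[ℂ] Halpha ⊗[ℂ] Halpha :=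
  MvPolynomial.aeval fun s => Algebra.TensorProduct.map toHalpha toHalpha (treeComul (V s))

/-- The co-unit of `H^α`, which vanishes on all the trees different from the root tree. -/
def alphaCounit : Halpha →ₐ[ℂ] ℂ := MvPolynomial.aeval fun _ => 0

/-! ### The electron propagator Hopf algebra -/

/-- `H^e`, the free associative algebra on all trees, with the root tree identified with `1`. -/
abbrev He : Type := FreeAlgebra ℂ {t : PBT // t ≠ .nil}

/-- A tree as an element of `H^e`: a generator, or the unit for the root tree. -/
def treeGen : PBT → He
  | .nil => 1
  | .node _ r s => FreeAlgebra.ι ℂ ⟨.node () r s, by simp⟩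

/-- The linear map from the span of all trees to `H^e`; it is not multiplicative. -/
def toHe : TreeAlg →ₗ[ℂ] He := linearExt treeGen

/-- The co-product of `H^e`: the multiplicative extension of the one dual to the under product. -/
def eComul : He →ₐ[ℂ] He ⊗[ℂ] He :=
  FreeAlgebra.lift ℂ fun t => TensorProduct.map toHe toHe (underComul t.1)

/-- The co-unit of `H^e`, which vanishes on all the generators. -/
def eCounit : He →ₐ[ℂ] ℂ := FreeAlgebra.lift ℂ fun _ => 0

/-- The co-action `δ^e` of `H^α` on `H^e`: the multiplicative extension of `δ^α`. -/
def eCoaction : He →ₐ[ℂ] He ⊗[ℂ] Halpha :=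
  FreeAlgebra.lift ℂ fun t => TensorProduct.map toHe toHalpha.toLinearMap (treeCoaction t.1)

/-! ### The two semi-direct co-products -/

/-- The algebra underlying `ℂ(G^dif) ⋉ H^inv`. -/
abbrev SeriesSmash : Type := CGdif ⊗[ℂ] Hinv

/-- The co-product of `ℂ(G^dif) ⋉ H^inv`. -/
def seriesComul : SeriesSmash →ₐ[ℂ] SeriesSmash ⊗[ℂ] SeriesSmash :=
  smashComul difComul invComul difCoaction

/-- The co-unit of `ℂ(G^dif) ⋉ H^inv`. -/
def seriesCounit : SeriesSmash →ₐ[ℂ] ℂ := smashCounit difCounit invCounit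

/-- The algebra underlying `H^α ⋉ H^e`. -/
abbrev QEDSmash : Type := Halpha ⊗[ℂ] He

/-- The co-product of `H^α ⋉ H^e`. -/
def qedComul : QEDSmash →ₐ[ℂ] QEDSmash ⊗[ℂ] QEDSmash :=
  smashComul alphaComul eComul eCoaction

/-- The co-unit of `H^α ⋉ H^e`. -/
def qedCounit : QEDSmash →ₐ[ℂ] ℂ := smashCounit alphaCounit eCounit

end QEDHopf

end

noncomputable section

namespace QEDHopf

/-! ### Antipodes of conilpotent bialgebras -/

section LeftFactors

variable {R A : Type*} [CommRing R] [Ring A] [Algebra R A]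

/-! The generating series T(x) = ∑ t_n x^n satisfies T = 1 + x T V(T) for the over product, because
r ∨ s = r / V(s) (`treeSum_succ`). Fed into the recursive definitions, this gives by a simultaneous
induction Δ^α t_n = ∑ t_k ⊗ [x^{n-k}] T^{k+1} and δ^α t_n = ∑ t_k ⊗ [x^{n-k}] T^k
(`coactionLin_comulHom_treeSum`), and likewise Δ^p_e t_n = ∑ t_k ⊗ t_{n-k} (`underLin_treeSum`).
Since A(x) = x ∑ a_n x^n, these are exactly the formulas that define the series side, so Ω and j
respect all the structure maps. Both have left inverses that only see the right combs, one tree for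
each order (`omegaInv`, `jInv`).

That H ⋉ B is a bialgebra is formal once H and B are bialgebras, δ is a co-action, and the
co-product and co-unit of B are compatible with δ (`smash_coassoc`, `smash_rTensor`,
`smash_lTensor`). For trees these facts are proved in the span of all trees, before Abelianisation,
by induction on r ∨ s = r / V(s), the main tool being δ(x / V(y)) = Δ(x) (V ⊗ Id)δ(y)
(`tree_coassoc`, `under_coassoc`, `underTensorId_treeCoaction`). On the series side they are pulled
back along the split injection Ω ⊗ j.

For the antipode, every generator satisfies Δ x = x ⊗ 1 + (terms whose left factors come earlier).
Hence on each element the geometric series ∑ (ε - Id)^k for convolution is a finite sum, and it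
inverts the identity (`IsHopf.of_adjoin`). Bialgebra morphisms then commute with antipodes, by
uniqueness of convolution inverses. -/

theorem tmul_mem_range_rTensor {P : Submodule R A} {x : A} (hx : x ∈ P) (y : A) :
    x ⊗ₜ[R] y ∈ LinearMap.range (P.subtype.rTensor A) :=
  ⟨⟨x, hx⟩ ⊗ₜ y, rfl⟩

theorem range_rTensor_mono {P Q : Submodule R A} (h : P ≤ Q) :
    LinearMap.range (P.subtype.rTensor A) ≤ LinearMap.range (Q.subtype.rTensor A) := by
  rintro _ ⟨z, rfl⟩
  induction z with
  | zero => simp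
  | add p q hp hq => rw [map_add]; exact add_mem hp hq
  | tmul p q => exact tmul_mem_range_rTensor (h p.2) q

theorem mul_mem_range_rTensor {P Q W : Submodule R A} (h : ∀ x ∈ P, ∀ y ∈ Q, x * y ∈ W)
    {p q : A ⊗[R] A} (hp : p ∈ LinearMap.range (P.subtype.rTensor A))
    (hq : q ∈ LinearMap.range (Q.subtype.rTensor A)) :
    p * q ∈ LinearMap.range (W.subtype.rTensor A) := by
  obtain ⟨z, rfl⟩ := hp
  obtain ⟨w, rfl⟩ := hq
  induction z with
  | zero => simp
  | add p q hp hq => rw [map_add, add_mul]; exact add_mem hp hq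
  | tmul p p' =>
    induction w with
    | zero => simp
    | add p q hp hq => rw [map_add, mul_add]; exact add_mem hp hq
    | tmul q q' =>
      simp only [LinearMap.rTensor_tmul, Submodule.subtype_apply,
        Algebra.TensorProduct.tmul_mul_tmul]
      exact tmul_mem_range_rTensor (h _ p.2 _ q.2) _

end LeftFactors

section Conilpotent

variable {R A : Type*} [CommRing R] [Ring A] [Bialgebra R A]

variable (R A) in
/-- The increasing filtration of a bialgebra that starts with the scalars and whose next step
consists of the `x` such that `Δ x - x ⊗ 1` has its left factors in the previous one. -/
def conilFiltration : ℕ → Submodule R A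
  | 0 => R ∙ (1 : A)
  | n + 1 => (LinearMap.range ((conilFiltration n).subtype.rTensor A)).comap
      (Coalgebra.comul - (TensorProduct.mk R A A).flip 1)

theorem mem_conilFiltration_succ {n : ℕ} {x : A} :
    x ∈ conilFiltration R A (n + 1) ↔ ∃ z ∈ LinearMap.range
      ((conilFiltration R A n).subtype.rTensor A), Coalgebra.comul x = x ⊗ₜ[R] 1 + z := by
  simp only [conilFiltration, Submodule.mem_comap, LinearMap.sub_apply, LinearMap.flip_apply,
    TensorProduct.mk_apply]
  constructor
  · intro h
    exact ⟨_, h, by abel⟩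
  · rintro ⟨z, hz, h⟩
    rw [h]
    simpa using hz

theorem conilFiltration_mono : Monotone (conilFiltration R A) := by
  refine monotone_nat_of_le_succ fun n => ?_
  induction n with
  | zero =>
    intro x hx
    obtain ⟨r, rfl⟩ := Submodule.mem_span_singleton.1 hx
    refine mem_conilFiltration_succ.2 ⟨0, zero_mem _, ?_⟩
    simp [Algebra.TensorProduct.one_def, TensorProduct.smul_tmul']
  | succ n ih =>
    intro x hx
    obtain ⟨z, hz, h⟩ := mem_conilFiltration_succ.1 hx
    exact mem_conilFiltration_succ.2 ⟨z, range_rTensor_mono ih hz, h⟩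

/-- If Δ x = x ⊗ 1 + z and Δ y = y ⊗ 1 + w, then Δ(xy) - xy ⊗ 1 = (x ⊗ 1)w + z(y ⊗ 1) + zw, and each
of the three terms has its left factors in a product of smaller total degree, which allows induction
on m + n. -/
theorem mul_mem_conilFiltration {m n : ℕ} {x y : A} (hx : x ∈ conilFiltration R A m)
    (hy : y ∈ conilFiltration R A n) : x * y ∈ conilFiltration R A (m + n) := by
  induction hk : m + n using Nat.strong_induction_on generalizing m n x y with
  | _ k ih =>
    subst hk
    rcases m with _ | m
    · obtain ⟨r, rfl⟩ := Submodule.mem_span_singleton.1 hx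
      simpa using Submodule.smul_mem _ r hy
    rcases n with _ | n
    · obtain ⟨r, rfl⟩ := Submodule.mem_span_singleton.1 hy
      simpa using Submodule.smul_mem _ r hx
    obtain ⟨z, hz, h⟩ := mem_conilFiltration_succ.1 hx
    obtain ⟨w, hw, h'⟩ := mem_conilFiltration_succ.1 hy
    refine (mem_conilFiltration_succ (n := m + 1 + n)).2
      ⟨x ⊗ₜ 1 * w + z * (y ⊗ₜ 1) + z * w, ?_, ?_⟩
    · refine add_mem (add_mem ?_ ?_) ?_
      · exact mul_mem_range_rTensor (fun u hu v hv => ih (m + 1 + n) (by omega) hu hv rfl)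
          (tmul_mem_range_rTensor hx 1) hw
      · exact mul_mem_range_rTensor (fun u hu v hv => (by
          have := ih (m + (n + 1)) (by omega) hu hv rfl
          rwa [show m + 1 + n = m + (n + 1) by omega]))
          hz (tmul_mem_range_rTensor hy 1)
      · exact mul_mem_range_rTensor (fun u hu v hv => conilFiltration_mono (by omega)
          (ih (m + n) (by omega) hu hv rfl)) hz hw
    · rw [Bialgebra.comul_mul, h, h', add_mul, mul_add, mul_add,
        Algebra.TensorProduct.tmul_mul_tmul, mul_one]
      abel

variable (R A) in
/-- The union of the filtration, as a subalgebra. -/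
def conilSubalgebra : Subalgebra R A where
  carrier := {x | ∃ n, x ∈ conilFiltration R A n}
  mul_mem' := fun ⟨_, hx⟩ ⟨_, hy⟩ => ⟨_, mul_mem_conilFiltration hx hy⟩
  add_mem' := fun ⟨m, hx⟩ ⟨n, hy⟩ => ⟨max m n, add_mem
    (conilFiltration_mono (le_max_left m n) hx) (conilFiltration_mono (le_max_right m n) hy)⟩
  algebraMap_mem' r := ⟨0, Submodule.mem_span_singleton.2 ⟨r, (Algebra.algebraMap_eq_smul_one r).symm⟩⟩

theorem mem_conilSubalgebra {x : A} :
    x ∈ conilSubalgebra R A ↔ ∃ n, x ∈ conilFiltration R A n := Iff.rfl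

/-- A tensor involves finitely many left factors, so a single step of the filtration contains them
all. -/
theorem exists_range_rTensor_of_forall_mem {P : Submodule R A} {z : A ⊗[R] A}
    (hP : P ≤ (conilSubalgebra R A).toSubmodule)
    (hz : z ∈ LinearMap.range (P.subtype.rTensor A)) :
    ∃ n, z ∈ LinearMap.range ((conilFiltration R A n).subtype.rTensor A) := by
  obtain ⟨w, rfl⟩ := hz
  induction w with
  | zero => exact ⟨0, by simp⟩
  | add p q hp hq =>
    obtain ⟨m, hm⟩ := hp
    obtain ⟨n, hn⟩ := hq
    refine ⟨max m n, ?_⟩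
    rw [map_add]
    exact add_mem (range_rTensor_mono (conilFiltration_mono (le_max_left m n)) hm)
      (range_rTensor_mono (conilFiltration_mono (le_max_right m n)) hn)
  | tmul p q =>
    obtain ⟨n, hn⟩ := hP p.2
    exact ⟨n, tmul_mem_range_rTensor hn q⟩

/-- An element belongs to the union of the filtration as soon as the left factors of
`Δ x - x ⊗ 1` do. -/
theorem mem_conilSubalgebra_of_comul {x : A} {z : A ⊗[R] A}
    (hz : z ∈ LinearMap.range ((conilSubalgebra R A).toSubmodule.subtype.rTensor A))
    (h : Coalgebra.comul x = x ⊗ₜ[R] 1 + z) : x ∈ conilSubalgebra R A := by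
  obtain ⟨n, hn⟩ := exists_range_rTensor_of_forall_mem le_rfl hz
  exact ⟨n + 1, mem_conilFiltration_succ.2 ⟨z, hn, h⟩⟩

/-! ### The convolution inverse of the identity as a geometric series -/

open WithConv LinearMap

variable (R A) in
/-- The opposite `x ↦ ε(x) 1 - x` of the projection onto the augmentation ideal. -/
def augProj : WithConv (A →ₗ[R] A) := 1 - toConv LinearMap.id

theorem augProj_one : augProj R A 1 = 0 := by
  change algebraMap R A (Coalgebra.counit (1 : A)) - (1 : A) = 0
  simp

/-- The last convolution factor is peeled off. It kills the right factor of x ⊗ 1, and the remaining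
terms of Δ x have left factors one step lower, killed by the k-th power by induction. This is why
only left factors need to be filtered. -/
theorem augProj_pow_eq_zero {n k : ℕ} (hk : n < k) {x : A} (hx : x ∈ conilFiltration R A n) :
    (augProj R A ^ k) x = 0 := by
  induction k generalizing n x with
  | zero => omega
  | succ k ih =>
    rw [pow_succ, convMul_apply]
    rcases n with _ | n
    · obtain ⟨r, rfl⟩ := Submodule.mem_span_singleton.1 hx
      rw [map_smul, Bialgebra.comul_one, Algebra.TensorProduct.one_def, map_smul, map_smul,
        TensorProduct.map_tmul, mul'_apply]
      have := augProj_one (R := R) (A := A)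
      change (augProj R A).ofConv 1 = 0 at this
      rw [this, mul_zero, smul_zero]
    · obtain ⟨z, ⟨w, rfl⟩, h⟩ := mem_conilFiltration_succ.1 hx
      rw [h, map_add, map_add, TensorProduct.map_tmul, mul'_apply]
      have := augProj_one (R := R) (A := A)
      change (augProj R A).ofConv 1 = 0 at this
      rw [this, mul_zero, zero_add]
      clear h hx
      induction w with
      | zero => simp
      | add p q hp hq => rw [map_add, map_add, map_add, hp, hq, add_zero]
      | tmul p q =>
        have := ih (n := n) (by omega) p.2
        change (augProj R A ^ k).ofConv p = 0 at this
        rw [rTensor_tmul, TensorProduct.map_tmul, mul'_apply, Submodule.subtype_apply, this,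
          zero_mul]

variable (R A) in
/-- Partial sums of the geometric series that inverts the identity for convolution. -/
def antipodeApprox (n : ℕ) : WithConv (A →ₗ[R] A) :=
  ∑ k ∈ Finset.range n, augProj R A ^ k

theorem antipodeApprox_succ_apply (n : ℕ) (x : A) :
    antipodeApprox R A (n + 1) x = antipodeApprox R A n x + (augProj R A ^ n) x := by
  rw [antipodeApprox, Finset.sum_range_succ]
  rfl

theorem antipodeApprox_eq {m n : ℕ} {x : A} (hx : x ∈ conilFiltration R A m) (h : m < n) :
    antipodeApprox R A n x = antipodeApprox R A (m + 1) x := by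
  induction n, h using Nat.le_induction with
  | base => rfl
  | succ n hn ih => rw [antipodeApprox_succ_apply, augProj_pow_eq_zero hn hx, add_zero, ih]

/-- The partial sums stabilise on each element, at a rank that depends on the element. Linearity of
the limit is read off from a partial sum beyond the ranks of all the elements involved. -/
theorem exists_linearMap_eq_antipodeApprox (h : conilSubalgebra R A = ⊤) :
    ∃ S : A →ₗ[R] A, ∀ x, ∃ m, ∀ n, m < n → antipodeApprox R A n x = S x := by
  have hx : ∀ x : A, ∃ n, x ∈ conilFiltration R A n := fun x => by
    rw [← mem_conilSubalgebra, h]; trivial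
  choose m hm using hx
  have key : ∀ x n, m x < n → antipodeApprox R A n x = antipodeApprox R A (m x + 1) x :=
    fun x n hn => antipodeApprox_eq (hm x) hn
  refine ⟨{ toFun := fun x => antipodeApprox R A (m x + 1) x
            map_add' := fun x y => ?_
            map_smul' := fun r x => ?_ }, fun x => ⟨m x, key x⟩⟩
  · have hN : ∃ N, m x < N ∧ m y < N ∧ m (x + y) < N :=
      ⟨m x + m y + m (x + y) + 1, by omega, by omega, by omega⟩
    obtain ⟨N, h1, h2, h3⟩ := hN
    rw [← key x N h1, ← key y N h2, ← key (x + y) N h3]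
    exact (antipodeApprox R A N).ofConv.map_add x y
  · have hN : ∃ N, m x < N ∧ m (r • x) < N := ⟨m x + m (r • x) + 1, by omega, by omega⟩
    obtain ⟨N, h1, h2⟩ := hN
    rw [← key x N h1, ← key (r • x) N h2]
    exact (antipodeApprox R A N).ofConv.map_smul r x

theorem one_sub_augProj : 1 - augProj R A = toConv LinearMap.id := by
  rw [augProj]; abel

/-- The identity of a conilpotent bialgebra is invertible for convolution. -/
theorem exists_antipode_of_conilSubalgebra_eq_top (h : conilSubalgebra R A = ⊤) :
    ∃ S : A →ₗ[R] A, toConv S * toConv LinearMap.id = 1 ∧ toConv LinearMap.id * toConv S = 1 := by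
  obtain ⟨S, hS⟩ := exists_linearMap_eq_antipodeApprox h
  -- Stabilisation passes from elements to tensors, which are finite sums of pure ones; `hr` is the
  -- mirror statement for the other leg.
  have hl : ∀ z : A ⊗[R] A, ∃ m, ∀ n, m < n →
      TensorProduct.map (antipodeApprox R A n).ofConv LinearMap.id z =
        TensorProduct.map S LinearMap.id z := by
    intro z
    induction z with
    | zero => exact ⟨0, fun n _ => by simp⟩
    | add p q hp hq =>
      obtain ⟨k, hk⟩ := hp
      obtain ⟨l, hl⟩ := hq
      exact ⟨max k l, fun n hn => by rw [map_add, map_add, hk n (by omega), hl n (by omega)]⟩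
    | tmul p q =>
      obtain ⟨k, hk⟩ := hS p
      exact ⟨k, fun n hn => by
        rw [TensorProduct.map_tmul, TensorProduct.map_tmul, ← hk n hn]⟩
  have hr : ∀ z : A ⊗[R] A, ∃ m, ∀ n, m < n →
      TensorProduct.map LinearMap.id (antipodeApprox R A n).ofConv z =
        TensorProduct.map LinearMap.id S z := by
    intro z
    induction z with
    | zero => exact ⟨0, fun n _ => by simp⟩
    | add p q hp hq =>
      obtain ⟨k, hk⟩ := hp
      obtain ⟨l, hl⟩ := hq
      exact ⟨max k l, fun n hn => by rw [map_add, map_add, hk n (by omega), hl n (by omega)]⟩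
    | tmul p q =>
      obtain ⟨k, hk⟩ := hS q
      exact ⟨k, fun n hn => by
        rw [TensorProduct.map_tmul, TensorProduct.map_tmul, ← hk n hn]⟩
  have hone : ∀ x : A, ∃ m, ∀ n, m < n → (1 - augProj R A ^ n : WithConv (A →ₗ[R] A)) x =
      (1 : WithConv (A →ₗ[R] A)) x := by
    intro x
    obtain ⟨m, hm⟩ : x ∈ conilSubalgebra R A := by rw [h]; trivial
    refine ⟨m, fun n hn => ?_⟩
    change (1 : WithConv (A →ₗ[R] A)) x - (augProj R A ^ n) x = _
    rw [augProj_pow_eq_zero hn hm, sub_zero]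
  refine ⟨S, WithConv.ext (LinearMap.ext fun x => ?_), WithConv.ext (LinearMap.ext fun x => ?_)⟩
  · obtain ⟨k, hk⟩ := hl (Coalgebra.comul x)
    obtain ⟨l, hl⟩ := hone x
    have h1 := hk (max k l + 1) (by omega)
    have h2 := hl (max k l + 1) (by omega)
    -- With u = ε - Id, (∑_{k<N} u^k)(1 - u) = 1 - u^N and 1 - u is the identity map; N is taken
    -- large enough for u^N to vanish at x and for the sum to agree with S on Δ x.
    rw [← geom_sum_mul_neg, one_sub_augProj] at h2
    exact (congrArg (mul' R A) h1).symm.trans h2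
  · obtain ⟨k, hk⟩ := hr (Coalgebra.comul x)
    obtain ⟨l, hl⟩ := hone x
    have h1 := hk (max k l + 1) (by omega)
    have h2 := hl (max k l + 1) (by omega)
    rw [← mul_neg_geom_sum, one_sub_augProj] at h2
    exact (congrArg (mul' R A) h1).symm.trans h2

end Conilpotent

/-- A criterion for a bialgebra to be a Hopf algebra: every element of a generating set is reached
by the conilpotent filtration. -/
theorem IsHopf.of_adjoin {A : Type} [Ring A] [Algebra ℂ A] {Δ : A →ₐ[ℂ] A ⊗[ℂ] A}
    {ε : A →ₐ[ℂ] ℂ}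
    (coassoc : (Algebra.TensorProduct.assoc ℂ ℂ ℂ A A A).toAlgHom.comp
      ((Algebra.TensorProduct.map Δ (AlgHom.id ℂ A)).comp Δ) =
        (Algebra.TensorProduct.map (AlgHom.id ℂ A) Δ).comp Δ)
    (rTensor : (Algebra.TensorProduct.map ε (AlgHom.id ℂ A)).comp Δ =
      (Algebra.TensorProduct.lid ℂ A).symm)
    (lTensor : (Algebra.TensorProduct.map (AlgHom.id ℂ A) ε).comp Δ =
      (Algebra.TensorProduct.rid ℂ ℂ A).symm)
    (conil : ∀ C : Subalgebra ℂ A, (∀ x, ∀ z ∈ LinearMap.range (C.toSubmodule.subtype.rTensor A),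
      Δ x = x ⊗ₜ[ℂ] 1 + z → x ∈ C) → C = ⊤) : IsHopf Δ ε := by
  refine ⟨coassoc, rTensor, lTensor, ?_⟩
  let _ : Bialgebra ℂ A := Bialgebra.ofAlgHom Δ ε coassoc rTensor lTensor
  -- The subalgebra given to `conil` is the union of the filtration, which has the required closure
  -- property.
  obtain ⟨S, h1, h2⟩ := exists_antipode_of_conilSubalgebra_eq_top (R := ℂ) (A := A)
    (conil _ fun x z hz h => mem_conilSubalgebra_of_comul hz h)
  exact ⟨S, congrArg WithConv.ofConv h1, congrArg WithConv.ofConv h2⟩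

/-- Homomorphisms of bialgebras between Hopf algebras commute with the antipodes. -/
theorem bialgHom_antipode {R A B : Type*} [CommRing R] [Ring A] [Ring B] [HopfAlgebra R A]
    [HopfAlgebra R B] (f : A →ₐc[R] B) (x : A) :
    f (HopfAlgebra.antipode R x) = HopfAlgebra.antipode R (f x) := by
  have key : WithConv.toConv ((f : A →ₐ[R] B).toLinearMap ∘ₗ HopfAlgebra.antipode R) =
      WithConv.toConv (HopfAlgebra.antipode R ∘ₗ (f : A →ₗc[R] B).toLinearMap) := by
    -- In the convolution algebra of linear maps A → B, f ∘ S is a left inverse of f and S ∘ f is a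
    -- right inverse.
    apply left_inv_eq_right_inv (a := WithConv.toConv (f : A →ₐ[R] B).toLinearMap)
    · have := LinearMap.algHom_comp_convMul_distrib (f : A →ₐ[R] B)
        (WithConv.toConv (HopfAlgebra.antipode R (A := A))) (WithConv.toConv LinearMap.id)
      rw [LinearMap.antipode_mul_id] at this
      refine (congrArg WithConv.toConv this).symm.trans ?_
      ext y
      exact (f : A →ₐ[R] B).commutes _
    · have := LinearMap.convMul_comp_coalgHom_distrib (WithConv.toConv LinearMap.id)
        (WithConv.toConv (HopfAlgebra.antipode R (A := B))) (f : A →ₗc[R] B)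
      rw [LinearMap.id_mul_antipode] at this
      refine (congrArg WithConv.toConv this).symm.trans ?_
      ext y
      exact congrArg (algebraMap R B) (CoalgHomClass.counit_comp_apply f y)
  exact congrArg (fun g => g.ofConv x) key

/-! ### The bialgebra axioms for semi-direct co-products -/

section SmashBialgebra

open Algebra.TensorProduct

variable {H B : Type} [CommRing H] [Algebra ℂ H] [Ring B] [Algebra ℂ B]

variable (H B) in
/-- `(c ⊗ h) ⊗ d ↦ (1 ⊗ c) ⊗ (h ⊗ d)`. -/
def smashEmb : (B ⊗[ℂ] H) ⊗[ℂ] B →ₐ[ℂ] (H ⊗[ℂ] B) ⊗[ℂ] (H ⊗[ℂ] B) :=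
  (map includeRight (AlgHom.id ℂ (H ⊗[ℂ] B))).comp
    (Algebra.TensorProduct.assoc ℂ ℂ ℂ B H B).toAlgHom

theorem smashEmb_tmul (c : B) (h : H) (d : B) :
    smashEmb H B ((c ⊗ₜ h) ⊗ₜ d) = (1 ⊗ₜ c) ⊗ₜ (h ⊗ₜ d) := rfl

theorem smashRight_apply (ΔB : B →ₐ[ℂ] B ⊗[ℂ] B) (δ : B →ₐ[ℂ] B ⊗[ℂ] H) (b : B) :
    smashRight ΔB δ b = smashEmb H B (map δ (AlgHom.id ℂ B) (ΔB b)) := rfl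

theorem smashComul_tmul (ΔH : H →ₐ[ℂ] H ⊗[ℂ] H) (ΔB : B →ₐ[ℂ] B ⊗[ℂ] B)
    (δ : B →ₐ[ℂ] B ⊗[ℂ] H) (a : H) (b : B) :
    smashComul ΔH ΔB δ (a ⊗ₜ b) = smashLeft ΔH a * smashRight ΔB δ b := rfl

theorem smashComul_tmul_one (ΔH : H →ₐ[ℂ] H ⊗[ℂ] H) (ΔB : B →ₐ[ℂ] B ⊗[ℂ] B)
    (δ : B →ₐ[ℂ] B ⊗[ℂ] H) (a : H) :
    smashComul ΔH ΔB δ (a ⊗ₜ 1) = smashLeft ΔH a := by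
  rw [smashComul_tmul, map_one, mul_one]

theorem smashComul_one_tmul (ΔH : H →ₐ[ℂ] H ⊗[ℂ] H) (ΔB : B →ₐ[ℂ] B ⊗[ℂ] B)
    (δ : B →ₐ[ℂ] B ⊗[ℂ] H) (b : B) :
    smashComul ΔH ΔB δ (1 ⊗ₜ b) = smashRight ΔB δ b := by
  rw [smashComul_tmul, map_one, one_mul]

theorem smashCounit_tmul (εH : H →ₐ[ℂ] ℂ) (εB : B →ₐ[ℂ] ℂ) (a : H) (b : B) :
    smashCounit εH εB (a ⊗ₜ b) = εH a * εB b := rfl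

variable (H B) in
/-- `(c ⊗ h) ⊗ (d ⊗ k) ↦ (c ⊗ d) ⊗ h k`, the co-action on a tensor square. -/
def coactionMul : (B ⊗[ℂ] H) ⊗[ℂ] (B ⊗[ℂ] H) →ₐ[ℂ] (B ⊗[ℂ] B) ⊗[ℂ] H :=
  (map (AlgHom.id ℂ (B ⊗[ℂ] B)) (lmul' ℂ)).comp
    (tensorTensorTensorComm ℂ ℂ ℂ ℂ B H B H).toAlgHom

theorem coactionMul_tmul (c d : B) (h k : H) :
    coactionMul H B ((c ⊗ₜ h) ⊗ₜ (d ⊗ₜ k)) = (c ⊗ₜ d) ⊗ₜ (h * k) := rfl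

section Triple

/- The target `H ⊗ B` is replaced by an abstract algebra `T` with a map `τ` from it. -/

variable {T : Type} [Ring T] [Algebra ℂ T]

/-- `(c ⊗ h) ⊗ d ↦ τ(1 ⊗ c) ⊗ τ(h ⊗ d)`. -/
def pairEmb (τ : H ⊗[ℂ] B →ₐ[ℂ] T) : (B ⊗[ℂ] H) ⊗[ℂ] B →ₐ[ℂ] T ⊗[ℂ] T :=
  (map τ τ).comp (smashEmb H B)

theorem pairEmb_tmul (τ : H ⊗[ℂ] B →ₐ[ℂ] T) (c : B) (h : H) (d : B) :
    pairEmb τ ((c ⊗ₜ h) ⊗ₜ d) = τ (1 ⊗ₜ c) ⊗ₜ τ (h ⊗ₜ d) := rfl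

/-- `c ⊗ (h ⊗ k) ↦ τ(1 ⊗ c) ⊗ (τ(h ⊗ 1) ⊗ τ(k ⊗ 1))`. -/
def tripleEmb (τ : H ⊗[ℂ] B →ₐ[ℂ] T) : B ⊗[ℂ] (H ⊗[ℂ] H) →ₐ[ℂ] T ⊗[ℂ] (T ⊗[ℂ] T) :=
  map (τ.comp includeRight) (map (τ.comp includeLeft) (τ.comp includeLeft))

theorem tripleEmb_tmul (τ : H ⊗[ℂ] B →ₐ[ℂ] T) (c : B) (z : H ⊗[ℂ] H) :
    tripleEmb τ (c ⊗ₜ z) = τ (1 ⊗ₜ c) ⊗ₜ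
      (map (τ.comp includeLeft) (τ.comp includeLeft) z : T ⊗[ℂ] T) := rfl

variable {ΔH : H →ₐ[ℂ] H ⊗[ℂ] H} {ΔB : B →ₐ[ℂ] B ⊗[ℂ] B} {δ : B →ₐ[ℂ] B ⊗[ℂ] H}
  {τ : H ⊗[ℂ] B →ₐ[ℂ] T} {D : T →ₐ[ℂ] T ⊗[ℂ] T}

/-- `c ⊗ (d ⊗ e) ↦ ∑ τ(1 ⊗ c₀) ⊗ τ(c₁ ⊗ d₀) ⊗ τ(c₂ d₁ ⊗ e)`. -/
def tripleMap (ΔH : H →ₐ[ℂ] H ⊗[ℂ] H) (δ : B →ₐ[ℂ] B ⊗[ℂ] H) (τ : H ⊗[ℂ] B →ₐ[ℂ] T) :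
    B ⊗[ℂ] (B ⊗[ℂ] B) →ₗ[ℂ] T ⊗[ℂ] (T ⊗[ℂ] T) :=
  LinearMap.mul' ℂ (T ⊗[ℂ] (T ⊗[ℂ] T)) ∘ₗ TensorProduct.map
    ((tripleEmb τ).comp ((map (AlgHom.id ℂ B) ΔH).comp δ)).toLinearMap
    ((includeRight : _ →ₐ[ℂ] T ⊗[ℂ] (T ⊗[ℂ] T)).comp
      ((pairEmb τ).comp (map δ (AlgHom.id ℂ B)))).toLinearMap

theorem tripleMap_tmul (c : B) (z : B ⊗[ℂ] B) :
    tripleMap ΔH δ τ (c ⊗ₜ z) = tripleEmb τ (map (AlgHom.id ℂ B) ΔH (δ c)) *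
      (1 ⊗ₜ pairEmb τ (map δ (AlgHom.id ℂ B) z)) := rfl

/-- Applying D to τ(h ⊗ d) splits h by the co-product of H and d by that of B followed by δ; no
compatibility between δ and the co-products is needed on this side. -/
theorem id_tensor_apply_pairEmb
    (hD : ∀ h b, D (τ (h ⊗ₜ b)) = map (τ.comp includeLeft) (τ.comp includeLeft) (ΔH h) *
      pairEmb τ (map δ (AlgHom.id ℂ B) (ΔB b))) (w : B ⊗[ℂ] B) :
    map (AlgHom.id ℂ T) D (pairEmb τ (map δ (AlgHom.id ℂ B) w)) =
      tripleMap ΔH δ τ (map (AlgHom.id ℂ B) ΔB w) := by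
  induction w with
  | zero => simp
  | add p q hp hq => simp only [map_add, hp, hq]
  | tmul x z =>
    rw [map_tmul, map_tmul, tripleMap_tmul, AlgHom.id_apply, AlgHom.id_apply]
    generalize δ x = y
    induction y with
    | zero => simp
    | add p q hp hq => simp only [map_add, TensorProduct.add_tmul, add_mul, hp, hq]
    | tmul c h =>
      rw [pairEmb_tmul, map_tmul, hD, map_tmul, tripleEmb_tmul, tmul_mul_tmul, mul_one]
      rfl

/-- On this side the co-product of B acts on a leg that δ has already produced. Compatibility `hΔδ`
moves it before δ, and co-associativity `hδ` then turns the double co-action into δ followed by the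
co-product of H. -/
theorem apply_tensor_id_pairEmb
    (hD : ∀ b, D (τ (1 ⊗ₜ b)) = pairEmb τ (map δ (AlgHom.id ℂ B) (ΔB b)))
    (hδ : (Algebra.TensorProduct.assoc ℂ ℂ ℂ B H H).toAlgHom.comp
      ((map δ (AlgHom.id ℂ H)).comp δ) = (map (AlgHom.id ℂ B) ΔH).comp δ)
    (hΔδ : (map ΔB (AlgHom.id ℂ H)).comp δ = (coactionMul H B).comp ((map δ δ).comp ΔB))
    (w : B ⊗[ℂ] B) :
    Algebra.TensorProduct.assoc ℂ ℂ ℂ T T T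
      (map D (AlgHom.id ℂ T) (pairEmb τ (map δ (AlgHom.id ℂ B) w))) =
      tripleMap ΔH δ τ (Algebra.TensorProduct.assoc ℂ ℂ ℂ B B B (map ΔB (AlgHom.id ℂ B) w)) := by
  induction w with
  | zero => simp
  | add p q hp hq => simp only [map_add, hp, hq]
  | tmul x z =>
    -- (c ⊗ d) ⊗ h ↦ ∑ τ(1 ⊗ c₀) ⊗ τ(c₁ ⊗ d) ⊗ τ(h ⊗ 1). Through it, the left-hand side depends on x
    -- only via (ΔB ⊗ Id)(δ x), the expression that `hΔδ` rewrites.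
    set γ : (B ⊗[ℂ] B) ⊗[ℂ] H →ₐ[ℂ] T ⊗[ℂ] (T ⊗[ℂ] T) :=
      (Algebra.TensorProduct.assoc ℂ ℂ ℂ T T T).toAlgHom.comp
        (map ((pairEmb τ).comp (map δ (AlgHom.id ℂ B))) (τ.comp includeLeft)) with hγ
    have h1 : ∀ y : B ⊗[ℂ] H, Algebra.TensorProduct.assoc ℂ ℂ ℂ T T T
        (map D (AlgHom.id ℂ T) (pairEmb τ (y ⊗ₜ z))) =
        γ (map ΔB (AlgHom.id ℂ H) y) * (1 ⊗ₜ (1 ⊗ₜ τ (1 ⊗ₜ z))) := by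
      intro y
      induction y with
      | zero => simp
      | add p q hp hq => simp only [map_add, TensorProduct.add_tmul, add_mul, hp, hq]
      | tmul c h =>
        have : (1 : T) ⊗ₜ[ℂ] ((1 : T) ⊗ₜ[ℂ] τ ((1 : H) ⊗ₜ[ℂ] z)) =
          Algebra.TensorProduct.assoc ℂ ℂ ℂ T T T (1 ⊗ₜ τ (1 ⊗ₜ z)) := rfl
        rw [pairEmb_tmul, map_tmul, hD, map_tmul, this]
        change _ = (Algebra.TensorProduct.assoc ℂ ℂ ℂ T T T)
          (pairEmb τ (map δ (AlgHom.id ℂ B) (ΔB c)) ⊗ₜ τ (h ⊗ₜ 1)) * _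
        rw [← map_mul, tmul_mul_tmul, ← map_mul, tmul_mul_tmul, mul_one, mul_one, one_mul]
        rfl
    have h2 : ∀ p q : B ⊗[ℂ] H, γ (coactionMul H B (p ⊗ₜ q)) * (1 ⊗ₜ (1 ⊗ₜ τ (1 ⊗ₜ z))) =
        tripleEmb τ (Algebra.TensorProduct.assoc ℂ ℂ ℂ B H H
          (map δ (AlgHom.id ℂ H) p)) * (1 ⊗ₜ pairEmb τ (q ⊗ₜ z)) := by
      intro p q
      induction p with
      | zero => simp
      | add p q hp hq => simp only [map_add, TensorProduct.add_tmul, add_mul, hp, hq]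
      | tmul c k =>
        induction q with
        | zero => simp
        | add p q hp hq => simp only [map_add, TensorProduct.add_tmul, TensorProduct.tmul_add,
            add_mul, mul_add, hp, hq]
        | tmul d h =>
          rw [coactionMul_tmul, pairEmb_tmul, map_tmul, AlgHom.id_apply]
          change (Algebra.TensorProduct.assoc ℂ ℂ ℂ T T T)
            (pairEmb τ (δ c ⊗ₜ d) ⊗ₜ τ ((k * h) ⊗ₜ 1)) * _ = _
          generalize δ c = y
          induction y with
          | zero => simp
          | add p q hp hq => simp only [map_add, TensorProduct.add_tmul, add_mul, hp, hq]
          | tmul e l =>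
            rw [pairEmb_tmul, assoc_tmul, assoc_tmul, tripleEmb_tmul, map_tmul]
            simp [← map_mul]
    rw [map_tmul, AlgHom.id_apply, h1, map_tmul, AlgHom.id_apply]
    have h3 := DFunLike.congr_fun hΔδ x
    simp only [AlgHom.comp_apply] at h3
    rw [h3]
    generalize ΔB x = r
    induction r with
    | zero => simp
    | add p q hp hq => simp only [map_add, TensorProduct.add_tmul, add_mul, hp, hq]
    | tmul u v =>
      rw [map_tmul, h2, assoc_tmul, tripleMap_tmul, map_tmul]
      have h4 := DFunLike.congr_fun hδ u
      simp only [AlgHom.comp_apply] at h4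
      rw [← h4]
      rfl

/-- All the maps are multiplicative and a ⊗ b = (a ⊗ 1)(1 ⊗ b), so the two factors are treated
separately: the first reduces to co-associativity of H, the second, through `tripleMap`, to that of
B. -/
theorem coassoc_of_eq_mul_pairEmb
    (hD : ∀ h b, D (τ (h ⊗ₜ b)) = map (τ.comp includeLeft) (τ.comp includeLeft) (ΔH h) *
      pairEmb τ (map δ (AlgHom.id ℂ B) (ΔB b)))
    (hH : (Algebra.TensorProduct.assoc ℂ ℂ ℂ H H H).toAlgHom.comp
      ((map ΔH (AlgHom.id ℂ H)).comp ΔH) = (map (AlgHom.id ℂ H) ΔH).comp ΔH)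
    (hB : (Algebra.TensorProduct.assoc ℂ ℂ ℂ B B B).toAlgHom.comp
      ((map ΔB (AlgHom.id ℂ B)).comp ΔB) = (map (AlgHom.id ℂ B) ΔB).comp ΔB)
    (hδ : (Algebra.TensorProduct.assoc ℂ ℂ ℂ B H H).toAlgHom.comp
      ((map δ (AlgHom.id ℂ H)).comp δ) = (map (AlgHom.id ℂ B) ΔH).comp δ)
    (hΔδ : (map ΔB (AlgHom.id ℂ H)).comp δ = (coactionMul H B).comp ((map δ δ).comp ΔB))
    (a : H) (b : B) :
    Algebra.TensorProduct.assoc ℂ ℂ ℂ T T T (map D (AlgHom.id ℂ T) (D (τ (a ⊗ₜ b)))) =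
      map (AlgHom.id ℂ T) D (D (τ (a ⊗ₜ b))) := by
  have hD' : ∀ b, D (τ (1 ⊗ₜ b)) = pairEmb τ (map δ (AlgHom.id ℂ B) (ΔB b)) := fun b => by
    rw [hD, map_one, map_one, one_mul]
  have hD'' : ∀ a, D (τ (a ⊗ₜ 1)) = map (τ.comp includeLeft) (τ.comp includeLeft) (ΔH a) :=
    fun a => by rw [hD, map_one, map_one, map_one, mul_one]
  have hl : ∀ w : H ⊗[ℂ] H, Algebra.TensorProduct.assoc ℂ ℂ ℂ T T T
      (map D (AlgHom.id ℂ T) (map (τ.comp includeLeft) (τ.comp includeLeft) w)) =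
      map (τ.comp includeLeft) (map (τ.comp includeLeft) (τ.comp includeLeft))
        (Algebra.TensorProduct.assoc ℂ ℂ ℂ H H H (map ΔH (AlgHom.id ℂ H) w)) := by
    intro w
    induction w with
    | zero => simp
    | add p q hp hq => simp only [map_add, hp, hq]
    | tmul u v =>
      rw [map_tmul, map_tmul, AlgHom.comp_apply, includeLeft_apply, hD'', map_tmul]
      generalize ΔH u = r
      induction r with
      | zero => simp
      | add p q hp hq => simp only [map_add, TensorProduct.add_tmul, hp, hq]
      | tmul p q => rfl
  have hr : ∀ w : H ⊗[ℂ] H,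
      map (AlgHom.id ℂ T) D (map (τ.comp includeLeft) (τ.comp includeLeft) w) =
      map (τ.comp includeLeft) (map (τ.comp includeLeft) (τ.comp includeLeft))
        (map (AlgHom.id ℂ H) ΔH w) := by
    intro w
    induction w with
    | zero => simp
    | add p q hp hq => simp only [map_add, hp, hq]
    | tmul u v =>
      rw [map_tmul, map_tmul, AlgHom.comp_apply, AlgHom.comp_apply, includeLeft_apply,
        includeLeft_apply, hD'', map_tmul]
      rfl
  have ha : Algebra.TensorProduct.assoc ℂ ℂ ℂ T T T (map D (AlgHom.id ℂ T) (D (τ (a ⊗ₜ 1)))) =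
      map (AlgHom.id ℂ T) D (D (τ (a ⊗ₜ 1))) := by
    rw [hD'', hl, hr]
    exact congrArg _ (DFunLike.congr_fun hH a)
  have hb : Algebra.TensorProduct.assoc ℂ ℂ ℂ T T T (map D (AlgHom.id ℂ T) (D (τ (1 ⊗ₜ b)))) =
      map (AlgHom.id ℂ T) D (D (τ (1 ⊗ₜ b))) := by
    rw [hD', apply_tensor_id_pairEmb hD' hδ hΔδ, id_tensor_apply_pairEmb hD]
    exact congrArg _ (DFunLike.congr_fun hB b)
  have hab : a ⊗ₜ[ℂ] b = (a ⊗ₜ 1) * (1 ⊗ₜ b) := by simp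
  simp only [hab, map_mul, ha, hb]

end Triple

variable {ΔH : H →ₐ[ℂ] H ⊗[ℂ] H} {εH : H →ₐ[ℂ] ℂ} {ΔB : B →ₐ[ℂ] B ⊗[ℂ] B} {εB : B →ₐ[ℂ] ℂ}
  {δ : B →ₐ[ℂ] B ⊗[ℂ] H}

theorem smash_coassoc
    (hH : (Algebra.TensorProduct.assoc ℂ ℂ ℂ H H H).toAlgHom.comp
      ((map ΔH (AlgHom.id ℂ H)).comp ΔH) = (map (AlgHom.id ℂ H) ΔH).comp ΔH)
    (hB : (Algebra.TensorProduct.assoc ℂ ℂ ℂ B B B).toAlgHom.comp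
      ((map ΔB (AlgHom.id ℂ B)).comp ΔB) = (map (AlgHom.id ℂ B) ΔB).comp ΔB)
    (hδ : (Algebra.TensorProduct.assoc ℂ ℂ ℂ B H H).toAlgHom.comp
      ((map δ (AlgHom.id ℂ H)).comp δ) = (map (AlgHom.id ℂ B) ΔH).comp δ)
    (hΔδ : (map ΔB (AlgHom.id ℂ H)).comp δ = (coactionMul H B).comp ((map δ δ).comp ΔB)) :
    (Algebra.TensorProduct.assoc ℂ ℂ ℂ (H ⊗[ℂ] B) (H ⊗[ℂ] B) (H ⊗[ℂ] B)).toAlgHom.comp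
      ((map (smashComul ΔH ΔB δ) (AlgHom.id ℂ (H ⊗[ℂ] B))).comp (smashComul ΔH ΔB δ)) =
      (map (AlgHom.id ℂ (H ⊗[ℂ] B)) (smashComul ΔH ΔB δ)).comp (smashComul ΔH ΔB δ) := by
  apply Algebra.TensorProduct.ext'
  intro a b
  refine coassoc_of_eq_mul_pairEmb (τ := AlgHom.id ℂ (H ⊗[ℂ] B)) (fun h b => ?_) hH hB hδ hΔδ a b
  rw [pairEmb, map_id]
  rfl

theorem smash_rTensor
    (hH : (map εH (AlgHom.id ℂ H)).comp ΔH = (Algebra.TensorProduct.lid ℂ H).symm)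
    (hB : (map εB (AlgHom.id ℂ B)).comp ΔB = (Algebra.TensorProduct.lid ℂ B).symm)
    (hεδ : ∀ b, map εB (AlgHom.id ℂ H) (δ b) = εB b ⊗ₜ 1) :
    (map (smashCounit εH εB) (AlgHom.id ℂ (H ⊗[ℂ] B))).comp (smashComul ΔH ΔB δ) =
      (Algebra.TensorProduct.lid ℂ (H ⊗[ℂ] B)).symm := by
  apply Algebra.TensorProduct.ext'
  intro a b
  have ha : map (smashCounit εH εB) (AlgHom.id ℂ (H ⊗[ℂ] B)) (smashLeft ΔH a) =
      1 ⊗ₜ (a ⊗ₜ 1) := by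
    have : ∀ w : H ⊗[ℂ] H, map (smashCounit εH εB) (AlgHom.id ℂ (H ⊗[ℂ] B))
        (map (includeLeft : H →ₐ[ℂ] H ⊗[ℂ] B)
          (includeLeft : H →ₐ[ℂ] H ⊗[ℂ] B) w) =
        map (AlgHom.id ℂ ℂ) includeLeft (map εH (AlgHom.id ℂ H) w) := by
      intro w
      induction w with
      | zero => simp
      | add p q hp hq => simp only [map_add, hp, hq]
      | tmul u v => simp [smashCounit_tmul]
    rw [smashLeft, AlgHom.comp_apply, this]
    exact congrArg _ (DFunLike.congr_fun hH a)
  have hb : map (smashCounit εH εB) (AlgHom.id ℂ (H ⊗[ℂ] B)) (smashRight ΔB δ b) =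
      1 ⊗ₜ (1 ⊗ₜ b) := by
    have : ∀ w : B ⊗[ℂ] B, map (smashCounit εH εB) (AlgHom.id ℂ (H ⊗[ℂ] B))
        (smashEmb H B (map δ (AlgHom.id ℂ B) w)) =
        map (AlgHom.id ℂ ℂ) includeRight (map εB (AlgHom.id ℂ B) w) := by
      intro w
      induction w with
      | zero => simp
      | add p q hp hq => simp only [map_add, hp, hq]
      | tmul x z =>
        have h1 : ∀ y : B ⊗[ℂ] H, map (smashCounit εH εB) (AlgHom.id ℂ (H ⊗[ℂ] B))
            (smashEmb H B (y ⊗ₜ z)) = map (AlgHom.id ℂ ℂ) includeLeft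
              (map εB (AlgHom.id ℂ H) y) * (1 ⊗ₜ (1 ⊗ₜ z)) := by
          intro y
          induction y with
          | zero => simp
          | add p q hp hq => simp only [map_add, TensorProduct.add_tmul, add_mul, hp, hq]
          | tmul c h => simp [smashEmb_tmul, smashCounit_tmul]
        rw [map_tmul, AlgHom.id_apply, h1, hεδ]
        simp
    rw [smashRight_apply, this]
    exact congrArg _ (DFunLike.congr_fun hB b)
  change map (smashCounit εH εB) (AlgHom.id ℂ (H ⊗[ℂ] B)) (smashComul ΔH ΔB δ (a ⊗ₜ b)) =
    1 ⊗ₜ (a ⊗ₜ b)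
  rw [smashComul_tmul, map_mul, ha, hb]
  simp

theorem smash_lTensor
    (hH : (map (AlgHom.id ℂ H) εH).comp ΔH = (Algebra.TensorProduct.rid ℂ ℂ H).symm)
    (hB : (map (AlgHom.id ℂ B) εB).comp ΔB = (Algebra.TensorProduct.rid ℂ ℂ B).symm)
    (hδ : ∀ b, map (AlgHom.id ℂ B) εH (δ b) = b ⊗ₜ 1) :
    (map (AlgHom.id ℂ (H ⊗[ℂ] B)) (smashCounit εH εB)).comp (smashComul ΔH ΔB δ) =
      (Algebra.TensorProduct.rid ℂ ℂ (H ⊗[ℂ] B)).symm := by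
  apply Algebra.TensorProduct.ext'
  intro a b
  have ha : map (AlgHom.id ℂ (H ⊗[ℂ] B)) (smashCounit εH εB) (smashLeft ΔH a) =
      (a ⊗ₜ 1) ⊗ₜ 1 := by
    have : ∀ w : H ⊗[ℂ] H, map (AlgHom.id ℂ (H ⊗[ℂ] B)) (smashCounit εH εB)
        (map (includeLeft : H →ₐ[ℂ] H ⊗[ℂ] B)
          (includeLeft : H →ₐ[ℂ] H ⊗[ℂ] B) w) =
        map (includeLeft : H →ₐ[ℂ] H ⊗[ℂ] B) (AlgHom.id ℂ ℂ)
          (map (AlgHom.id ℂ H) εH w) := by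
      intro w
      induction w with
      | zero => simp
      | add p q hp hq => simp only [map_add, hp, hq]
      | tmul u v => simp [smashCounit_tmul]
    rw [smashLeft, AlgHom.comp_apply, this]
    exact congrArg _ (DFunLike.congr_fun hH a)
  have hb : map (AlgHom.id ℂ (H ⊗[ℂ] B)) (smashCounit εH εB) (smashRight ΔB δ b) =
      (1 ⊗ₜ b) ⊗ₜ 1 := by
    have : ∀ w : B ⊗[ℂ] B, map (AlgHom.id ℂ (H ⊗[ℂ] B)) (smashCounit εH εB)
        (smashEmb H B (map δ (AlgHom.id ℂ B) w)) =
        map (includeRight : B →ₐ[ℂ] H ⊗[ℂ] B) (AlgHom.id ℂ ℂ)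
          (map (AlgHom.id ℂ B) εB w) := by
      intro w
      induction w with
      | zero => simp
      | add p q hp hq => simp only [map_add, hp, hq]
      | tmul x z =>
        have h1 : ∀ y : B ⊗[ℂ] H, map (AlgHom.id ℂ (H ⊗[ℂ] B)) (smashCounit εH εB)
            (smashEmb H B (y ⊗ₜ z)) = map (includeRight : B →ₐ[ℂ] H ⊗[ℂ] B) (AlgHom.id ℂ ℂ)
              (map (AlgHom.id ℂ B) εH y) * (1 ⊗ₜ εB z) := by
          intro y
          induction y with
          | zero => simp
          | add p q hp hq => simp only [map_add, TensorProduct.add_tmul, add_mul, hp, hq]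
          | tmul c h => simp [smashEmb_tmul, smashCounit_tmul]
        rw [map_tmul, AlgHom.id_apply, h1, hδ]
        simp
    rw [smashRight_apply, this]
    exact congrArg _ (DFunLike.congr_fun hB b)
  change map (AlgHom.id ℂ (H ⊗[ℂ] B)) (smashCounit εH εB) (smashComul ΔH ΔB δ (a ⊗ₜ b)) =
    (a ⊗ₜ b) ⊗ₜ 1
  rw [smashComul_tmul, map_mul, ha, hb]
  simp

end SmashBialgebra

/-! ### Identities for the structure maps on trees -/

theorem linearExt_tree {M : Type} [AddCommMonoid M] [Module ℂ M] (f : PBT → M) (t : PBT) :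
    linearExt f (tree t) = f t :=
  (MonoidAlgebra.basis PBT ℂ).constr_basis ℂ f t

theorem treeAlg_induction {p : TreeAlg → Prop} (x : TreeAlg)
    (tree : ∀ t, p (tree t)) (add : ∀ x y, p x → p y → p (x + y))
    (smul : ∀ (c : ℂ) x, p x → p (c • x)) : p x := by
  induction x using MonoidAlgebra.induction_on with
  | of t => exact tree t
  | add x y hx hy => exact add x y hx hy
  | smul c x hx => exact smul c x hx

theorem tree_nil : tree .nil = 1 := rfl

theorem tree_mul (t s : PBT) : tree t * tree s = tree (overProd t s) :=
  (map_mul (MonoidAlgebra.of ℂ PBT) t s).symm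

theorem tree_mul_V (t s : PBT) : tree t * tree (V s) = tree (.node () t s) := tree_mul t (V s)

/-- The linear extension of `V`. -/
def linV : TreeAlg →ₗ[ℂ] TreeAlg := linearExt fun t => tree (V t)

theorem linV_tree (t : PBT) : linV (tree t) = tree (V t) := linearExt_tree _ t

theorem VTensorId_tmul (x y : TreeAlg) : VTensorId (x ⊗ₜ y) = linV x ⊗ₜ y := rfl

theorem treeComul_over (t s : PBT) :
    treeComul (overProd t s) = treeComul t * treeComul s := by
  induction s with
  | nil => rw [treeComul_nil, tree_nil_tmul, mul_one]; rfl
  | node _ r s hr _ => rw [overProd, treeComul_node, treeComul_node, hr, mul_assoc]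

/-- The co-product `Δ^α` as an algebra homomorphism. -/
def comulHom : TreeAlg →ₐ[ℂ] TreeAlg ⊗[ℂ] TreeAlg :=
  MonoidAlgebra.lift ℂ (TreeAlg ⊗[ℂ] TreeAlg) PBT
    { toFun := treeComul, map_one' := rfl, map_mul' := treeComul_over }

theorem comulHom_tree (t : PBT) : comulHom (tree t) = treeComul t := by
  exact MonoidAlgebra.lift_of _ t

/-- The linear extension of the co-action `δ^α`. -/
def coactionLin : TreeAlg →ₗ[ℂ] TreeAlg ⊗[ℂ] TreeAlg := linearExt treeCoaction

theorem coactionLin_tree (t : PBT) : coactionLin (tree t) = treeCoaction t := linearExt_tree _ t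

theorem coactionLin_linV (x : TreeAlg) : coactionLin (linV x) = VTensorId (coactionLin x) := by
  induction x using treeAlg_induction with
  | tree t => rw [linV_tree, coactionLin_tree, treeCoaction_V, coactionLin_tree]
  | add x y hx hy => simp only [map_add, hx, hy]
  | smul c x hx => simp only [map_smul, hx]

theorem comulHom_linV (x : TreeAlg) :
    comulHom (linV x) = 1 ⊗ₜ linV x + VTensorId (coactionLin x) := by
  induction x using treeAlg_induction with
  | tree t =>
    rw [linV_tree, comulHom_tree, treeComul_V, coactionLin_tree, treeCoaction_V]; rfl
  | add x y hx hy => simp only [map_add, hx, hy, TensorProduct.tmul_add]; abel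
  | smul c x hx => simp only [map_smul, hx, TensorProduct.tmul_smul, smul_add]

/-- The co-action is not multiplicative for the over product: the left factor goes through Δ^α
instead. Together with r ∨ s = r / V(s), this rule drives the inductions below. -/
theorem coactionLin_mul_linV (x y : TreeAlg) :
    coactionLin (x * linV y) = comulHom x * VTensorId (coactionLin y) := by
  induction x using treeAlg_induction with
  | add x y hx hy => simp only [map_add, hx, hy, add_mul]
  | smul c x hx => simp only [map_smul, hx, smul_mul_assoc]
  | tree r =>
    induction y using treeAlg_induction with
    | add x y hx hy => simp only [map_add, hx, hy, mul_add]
    | smul c x hx => simp only [map_smul, hx, mul_smul_comm]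
    | tree s =>
      rw [linV_tree, tree_mul_V, coactionLin_tree, treeCoaction_node, comulHom_tree,
        coactionLin_tree, treeCoaction_V]

/-! #### Co-associativity of `Δ^α` and of `δ^α` -/

section Coassoc

set_option maxSynthPendingDepth 6

open Algebra.TensorProduct

/-- `(Δ^α ⊗ Id)`, with values in `T ⊗ (T ⊗ T)`. -/
def comulTensorId : TreeAlg ⊗[ℂ] TreeAlg →ₐ[ℂ] TreeAlg ⊗[ℂ] (TreeAlg ⊗[ℂ] TreeAlg) :=
  (Algebra.TensorProduct.assoc ℂ ℂ ℂ TreeAlg TreeAlg TreeAlg).toAlgHom.comp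
    (map comulHom (AlgHom.id ℂ TreeAlg))

theorem comulTensorId_tmul (x y : TreeAlg) : comulTensorId (x ⊗ₜ y) =
    Algebra.TensorProduct.assoc ℂ ℂ ℂ TreeAlg TreeAlg TreeAlg (comulHom x ⊗ₜ y) := rfl

/-- `(δ^α ⊗ Id)`, with values in `T ⊗ (T ⊗ T)`. -/
def coactionTensorId : TreeAlg ⊗[ℂ] TreeAlg →ₗ[ℂ] TreeAlg ⊗[ℂ] (TreeAlg ⊗[ℂ] TreeAlg) :=
  (Algebra.TensorProduct.assoc ℂ ℂ ℂ TreeAlg TreeAlg TreeAlg).toAlgHom.toLinearMap ∘ₗ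
    (TensorProduct.map coactionLin LinearMap.id)

theorem coactionTensorId_tmul (x y : TreeAlg) : coactionTensorId (x ⊗ₜ y) =
    Algebra.TensorProduct.assoc ℂ ℂ ℂ TreeAlg TreeAlg TreeAlg (coactionLin x ⊗ₜ y) := rfl

theorem coactionTensorId_mul_VTensorId (x y : TreeAlg ⊗[ℂ] TreeAlg) :
    coactionTensorId (x * VTensorId y) = comulTensorId x * coactionTensorId (VTensorId y) := by
  induction x with
  | zero => simp
  | add x y hx hy => simp only [map_add, hx, hy, add_mul]
  | tmul p q =>
    induction y with
    | zero => simp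
    | add x y hx hy => simp only [map_add, hx, hy, mul_add]
    | tmul u v =>
      rw [VTensorId_tmul, tmul_mul_tmul, coactionTensorId_tmul, coactionTensorId_tmul,
        comulTensorId_tmul, ← map_mul, tmul_mul_tmul, coactionLin_mul_linV, coactionLin_linV]

theorem coactionTensorId_VTensorId (y : TreeAlg ⊗[ℂ] TreeAlg) :
    coactionTensorId (VTensorId y) =
      TensorProduct.map linV LinearMap.id (coactionTensorId y) := by
  induction y with
  | zero => simp
  | add x y hx hy => simp only [map_add, hx, hy]
  | tmul u v =>
    rw [VTensorId_tmul, coactionTensorId_tmul, coactionTensorId_tmul, coactionLin_linV]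
    generalize coactionLin u = z
    induction z with
    | zero => simp
    | add x y hx hy => simp only [map_add, TensorProduct.add_tmul, hx, hy]
    | tmul a b => rfl

/-- On the image of V the co-product and the co-action differ only by 1 ⊗ V(·). -/
theorem comulTensorId_VTensorId (y : TreeAlg ⊗[ℂ] TreeAlg) :
    comulTensorId (VTensorId y) = 1 ⊗ₜ VTensorId y + coactionTensorId (VTensorId y) := by
  induction y with
  | zero => simp
  | add x y hx hy => simp only [map_add, hx, hy, TensorProduct.tmul_add]; abel
  | tmul u v =>
    rw [VTensorId_tmul, coactionTensorId_tmul, comulTensorId_tmul, comulHom_linV,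
      coactionLin_linV, TensorProduct.add_tmul, map_add]
    rfl

/-- `(Id ⊗ Δ^α)`. -/
def idTensorComul : TreeAlg ⊗[ℂ] TreeAlg →ₐ[ℂ] TreeAlg ⊗[ℂ] (TreeAlg ⊗[ℂ] TreeAlg) :=
  map (AlgHom.id ℂ TreeAlg) comulHom

theorem idTensorComul_tmul (x y : TreeAlg) : idTensorComul (x ⊗ₜ y) = x ⊗ₜ comulHom y := rfl

theorem idTensorComul_VTensorId (y : TreeAlg ⊗[ℂ] TreeAlg) :
    idTensorComul (VTensorId y) = TensorProduct.map linV LinearMap.id (idTensorComul y) := by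
  induction y with
  | zero => simp
  | add x y hx hy => simp only [map_add, hx, hy]
  | tmul u v => rfl

/-- The two statements are proved together because both maps at r ∨ s involve Δ^α r and δ^α s. -/
theorem tree_coassoc (t : PBT) :
    comulTensorId (treeComul t) = idTensorComul (treeComul t) ∧
      coactionTensorId (treeCoaction t) = idTensorComul (treeCoaction t) := by
  induction t with
  | nil =>
    constructor
    · rw [treeComul_nil, tree_nil_tmul, map_one, map_one]
    · rw [treeCoaction_nil, coactionTensorId_tmul, coactionLin_tree, idTensorComul_tmul,
        comulHom_tree]
      rfl
  | node _ r s hr hs =>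
    have hV : coactionTensorId (VTensorId (treeCoaction s)) =
        idTensorComul (VTensorId (treeCoaction s)) := by
      rw [coactionTensorId_VTensorId, hs.2, idTensorComul_VTensorId]
    constructor
    -- For the factor V(s), (Δ ⊗ Id)Δ V(s) = 1 ⊗ 1 ⊗ V(s) + 1 ⊗ δV(s) + (δ ⊗ Id)δV(s); the first two
    -- terms form 1 ⊗ ΔV(s), and the third is (Id ⊗ Δ)δV(s) by `hV`.
    · rw [treeComul_node, map_mul, map_mul, hr.1, treeComul_V, map_add, map_add, treeCoaction_V,
        comulTensorId_VTensorId, hV, idTensorComul_tmul, comulHom_tree, treeComul_V,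
        treeCoaction_V, TensorProduct.tmul_add, tree_nil, add_assoc, comulTensorId_tmul, map_one]
      rfl
    · rw [treeCoaction_node, treeCoaction_V, coactionTensorId_mul_VTensorId, hV, hr.1, map_mul]

end Coassoc

/-! #### Co-units -/

section Counit

open Algebra.TensorProduct

/-- The co-unit on trees. -/
def treeCounit : TreeAlg →ₐ[ℂ] ℂ := alphaCounit.comp toHalpha

theorem toHalpha_tree (t : PBT) : toHalpha (tree t) = treeClass t := by
  exact MonoidAlgebra.lift_of _ t

theorem treeCounit_tree (t : PBT) : treeCounit (tree t) = if t = .nil then 1 else 0 := by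
  rw [treeCounit, AlgHom.comp_apply, toHalpha_tree]
  cases t <;> simp [treeClass, alphaCounit]

theorem treeCounit_linV (x : TreeAlg) : treeCounit (linV x) = 0 := by
  induction x using treeAlg_induction with
  | tree t => rw [linV_tree, treeCounit_tree, if_neg (by simp [V])]
  | add x y hx hy => simp only [map_add, hx, hy, add_zero]
  | smul c x hx => simp only [map_smul, hx, smul_zero]

theorem treeCounit_tensor_VTensorId (y : TreeAlg ⊗[ℂ] TreeAlg) :
    map treeCounit (AlgHom.id ℂ TreeAlg) (VTensorId y) = 0 := by
  induction y with
  | zero => simp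
  | add x y hx hy => simp only [map_add, hx, hy, add_zero]
  | tmul u v => rw [VTensorId_tmul, map_tmul, treeCounit_linV, TensorProduct.zero_tmul]

theorem treeCounit_tensor_treeCoaction (t : PBT) :
    map treeCounit (AlgHom.id ℂ TreeAlg) (treeCoaction t) = treeCounit (tree t) ⊗ₜ 1 := by
  cases t with
  | nil => rfl
  | node _ r s =>
    rw [treeCoaction_node, treeCoaction_V, map_mul, treeCounit_tensor_VTensorId, mul_zero,
      treeCounit_tree, if_neg (by simp), TensorProduct.zero_tmul]

theorem treeCounit_tensor_treeComul (t : PBT) :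
    map treeCounit (AlgHom.id ℂ TreeAlg) (treeComul t) = 1 ⊗ₜ tree t := by
  induction t with
  | nil => rw [treeComul_nil, tree_nil_tmul, map_one]; rfl
  | node _ r s hr _ =>
    rw [treeComul_node, treeComul_V, map_mul, hr, treeCoaction_V, map_add,
      treeCounit_tensor_VTensorId, map_tmul, tree_nil, map_one, add_zero, tmul_mul_tmul,
      AlgHom.id_apply, tree_mul_V, mul_one]

theorem tensor_treeCounit_VTensorId (y : TreeAlg ⊗[ℂ] TreeAlg) :
    map (AlgHom.id ℂ TreeAlg) treeCounit (VTensorId y) =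
      TensorProduct.map linV LinearMap.id (map (AlgHom.id ℂ TreeAlg) treeCounit y) := by
  induction y with
  | zero => simp
  | add x y hx hy => simp only [map_add, hx, hy]
  | tmul u v => rfl

theorem tensor_treeCounit (t : PBT) :
    map (AlgHom.id ℂ TreeAlg) treeCounit (treeComul t) = tree t ⊗ₜ 1 ∧
      map (AlgHom.id ℂ TreeAlg) treeCounit (treeCoaction t) = tree t ⊗ₜ 1 := by
  induction t with
  | nil =>
    rw [treeComul_nil, treeCoaction_nil, map_tmul, tree_nil, map_one treeCounit]
    exact ⟨rfl, rfl⟩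
  | node _ r s hr hs =>
    have hV : map (AlgHom.id ℂ TreeAlg) treeCounit (VTensorId (treeCoaction s)) =
        tree (V s) ⊗ₜ 1 := by
      rw [tensor_treeCounit_VTensorId, hs.2, TensorProduct.map_tmul, linV_tree]
      rfl
    constructor
    · rw [treeComul_node, treeComul_V, treeCoaction_V, map_mul, map_add, hV, hr.1, map_tmul,
        treeCounit_tree, if_neg (by simp [V]), TensorProduct.tmul_zero, zero_add, tmul_mul_tmul,
        tree_mul_V, mul_one]
    · rw [treeCoaction_node, treeCoaction_V, map_mul, hV, hr.1, tmul_mul_tmul,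
        tree_mul_V, mul_one]

end Counit

/-! #### The co-product dual to the under product -/

section Under

set_option maxSynthPendingDepth 6

open Algebra.TensorProduct

/-- The linear extension of the co-product dual to the under product. -/
def underLin : TreeAlg →ₗ[ℂ] TreeAlg ⊗[ℂ] TreeAlg := linearExt underComul

theorem underLin_tree (t : PBT) : underLin (tree t) = underComul t := linearExt_tree _ t

theorem underLin_one : underLin 1 = 1 := underLin_tree .nil

/-- Writing r ∨ u as r / V(u) expresses the under co-product by the over product and V, so that it
can be compared with δ^α. -/
theorem underComul_node (r s : PBT) : underComul (.node () r s) =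
    1 ⊗ₜ tree (.node () r s) + (tree r ⊗ₜ 1) * VTensorId (underComul s) := by
  rw [underComul, tree_nil]
  congr 1
  generalize underComul s = y
  induction y with
  | zero => simp
  | add x y hx hy => simp only [map_add, hx, hy, mul_add]
  | tmul u v =>
    rw [TensorProduct.map_tmul, VTensorId_tmul, tmul_mul_tmul, one_mul, LinearMap.id_apply]
    congr 1
    induction u using treeAlg_induction with
    | add x y hx hy => simp only [map_add, hx, hy, mul_add]
    | smul c x hx => simp only [map_smul, hx, mul_smul_comm]
    | tree s => rw [linearExt_tree, linV_tree, tree_mul_V]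

theorem underLin_mul_linV (x y : TreeAlg) :
    underLin (x * linV y) = 1 ⊗ₜ (x * linV y) + (x ⊗ₜ 1) * VTensorId (underLin y) := by
  induction x using treeAlg_induction with
  | add x y hx hy => simp only [map_add, hx, hy, add_mul, TensorProduct.tmul_add,
      TensorProduct.add_tmul]; abel
  | smul c x hx => simp only [map_smul, hx, smul_mul_assoc, TensorProduct.tmul_smul, smul_add,
      ← TensorProduct.smul_tmul']
  | tree r =>
    induction y using treeAlg_induction with
    | add x y hx hy => simp only [map_add, hx, hy, mul_add, TensorProduct.tmul_add]; abel
    | smul c x hx => simp only [map_smul, hx, mul_smul_comm, TensorProduct.tmul_smul, smul_add]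
    | tree s => rw [linV_tree, tree_mul_V, underLin_tree, underComul_node, underLin_tree]

/-- `Δ ⊗ Id` for the co-product dual to the under product. -/
def underTensorId : TreeAlg ⊗[ℂ] TreeAlg →ₗ[ℂ] (TreeAlg ⊗[ℂ] TreeAlg) ⊗[ℂ] TreeAlg :=
  TensorProduct.map underLin LinearMap.id

/-- `V ⊗ Id ⊗ Id`. -/
def VTensorIdId :
    (TreeAlg ⊗[ℂ] TreeAlg) ⊗[ℂ] TreeAlg →ₗ[ℂ] (TreeAlg ⊗[ℂ] TreeAlg) ⊗[ℂ] TreeAlg :=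
  TensorProduct.map VTensorId LinearMap.id

/-- `x ⊗ y ↦ x ⊗ 1 ⊗ y`. -/
def insertMid : TreeAlg ⊗[ℂ] TreeAlg →ₐ[ℂ] (TreeAlg ⊗[ℂ] TreeAlg) ⊗[ℂ] TreeAlg :=
  map includeLeft (AlgHom.id ℂ TreeAlg)

/-- `x ⊗ y ↦ 1 ⊗ x ⊗ y`. -/
def insertLeft : TreeAlg ⊗[ℂ] TreeAlg →ₐ[ℂ] (TreeAlg ⊗[ℂ] TreeAlg) ⊗[ℂ] TreeAlg :=
  map includeRight (AlgHom.id ℂ TreeAlg)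

/-- Applied with z = δ^α s and w = Δ^α r, this is the inductive step for compatibility with the
co-action; with w = r ⊗ 1 it is the one for co-associativity. -/
theorem underTensorId_mul_VTensorId (w z : TreeAlg ⊗[ℂ] TreeAlg) :
    underTensorId (w * VTensorId z) =
      insertLeft (w * VTensorId z) + insertMid w * VTensorIdId (underTensorId z) := by
  induction w with
  | zero => simp
  | add x y hx hy => simp only [map_add, hx, hy, add_mul]; abel
  | tmul p q =>
    induction z with
    | zero => simp
    | add x y hx hy => simp only [map_add, hx, hy, mul_add]; abel
    | tmul u v =>
      rw [VTensorId_tmul, tmul_mul_tmul, underTensorId, TensorProduct.map_tmul,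
        underLin_mul_linV, TensorProduct.map_tmul, VTensorIdId, TensorProduct.map_tmul,
        insertMid, map_tmul, tmul_mul_tmul, TensorProduct.add_tmul]
      rfl

theorem under_coassoc (t : PBT) :
    Algebra.TensorProduct.assoc ℂ ℂ ℂ TreeAlg TreeAlg TreeAlg (underTensorId (underComul t)) =
      TensorProduct.map LinearMap.id underLin (underComul t) := by
  induction t with
  | nil =>
    rw [underComul, underTensorId, TensorProduct.map_tmul, TensorProduct.map_tmul, underLin_tree,
      underComul]
    rfl
  | node _ r s _ hs =>
    have h1 : ∀ y : (TreeAlg ⊗[ℂ] TreeAlg) ⊗[ℂ] TreeAlg,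
        Algebra.TensorProduct.assoc ℂ ℂ ℂ TreeAlg TreeAlg TreeAlg
          (insertMid (tree r ⊗ₜ 1) * VTensorIdId y) = (tree r ⊗ₜ (1 ⊗ₜ 1)) *
            (TensorProduct.map linV LinearMap.id
              (Algebra.TensorProduct.assoc ℂ ℂ ℂ TreeAlg TreeAlg TreeAlg y)) := by
      intro y
      rw [map_mul]
      congr 1
      induction y with
      | zero => simp
      | add x y hx hy => simp only [map_add, hx, hy]
      | tmul x c =>
        induction x with
        | zero => simp
        | add x y hx hy => simp only [map_add, TensorProduct.add_tmul, hx, hy]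
        | tmul a b => rfl
    have h2 : ∀ y : TreeAlg ⊗[ℂ] TreeAlg,
        TensorProduct.map LinearMap.id underLin ((tree r ⊗ₜ 1) * VTensorId y) =
          (tree r ⊗ₜ (1 ⊗ₜ 1)) * (TensorProduct.map linV LinearMap.id
            (TensorProduct.map LinearMap.id underLin y)) := by
      intro y
      induction y with
      | zero => simp
      | add x y hx hy => simp only [map_add, mul_add, hx, hy]
      | tmul a b =>
        rw [VTensorId_tmul, tmul_mul_tmul, one_mul, TensorProduct.map_tmul,
          TensorProduct.map_tmul, TensorProduct.map_tmul, tmul_mul_tmul,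
          ← Algebra.TensorProduct.one_def, one_mul]
        rfl
    have h3 : ∀ y : TreeAlg ⊗[ℂ] TreeAlg,
        Algebra.TensorProduct.assoc ℂ ℂ ℂ TreeAlg TreeAlg TreeAlg (insertLeft y) = 1 ⊗ₜ y := by
      intro y
      induction y with
      | zero => simp
      | add x y hx hy => simp only [map_add, TensorProduct.tmul_add, hx, hy]
      | tmul a b => rfl
    rw [underComul_node, map_add, map_add, underTensorId_mul_VTensorId, map_add, h1, hs, map_add,
      h2, h3, ← add_assoc]
    congr 1
    rw [underTensorId, TensorProduct.map_tmul, TensorProduct.map_tmul, underLin_tree,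
      underComul_node, underLin_one, TensorProduct.tmul_add]
    rfl

/-- `(a ⊗ b) ⊗ (c ⊗ d) ↦ (a ⊗ c) ⊗ b d`. -/
def mulRight : (TreeAlg ⊗[ℂ] TreeAlg) ⊗[ℂ] (TreeAlg ⊗[ℂ] TreeAlg) →ₗ[ℂ]
    (TreeAlg ⊗[ℂ] TreeAlg) ⊗[ℂ] TreeAlg :=
  TensorProduct.map LinearMap.id (LinearMap.mul' ℂ TreeAlg) ∘ₗ
    (TensorProduct.tensorTensorTensorComm ℂ TreeAlg TreeAlg TreeAlg TreeAlg).toLinearMap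

theorem mulRight_tmul (a b c d : TreeAlg) :
    mulRight ((a ⊗ₜ b) ⊗ₜ (c ⊗ₜ d)) = (a ⊗ₜ c) ⊗ₜ (b * d) := rfl

theorem mulRight_mul_VTensorId (w z y : TreeAlg ⊗[ℂ] TreeAlg) :
    mulRight ((w * VTensorId z) ⊗ₜ y) = insertMid w * VTensorIdId (mulRight (z ⊗ₜ y)) := by
  induction w with
  | zero => simp
  | add p q hp hq => simp only [map_add, add_mul, TensorProduct.add_tmul, hp, hq]
  | tmul a b =>
    induction z with
    | zero => simp
    | add p q hp hq => simp only [map_add, mul_add, TensorProduct.add_tmul, hp, hq]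
    | tmul c d =>
      induction y with
      | zero => simp
      | add p q hp hq => simp only [map_add, mul_add, TensorProduct.tmul_add, hp, hq]
      | tmul e f =>
        rw [VTensorId_tmul, tmul_mul_tmul, mulRight_tmul, mulRight_tmul, VTensorIdId,
          TensorProduct.map_tmul, VTensorId_tmul, insertMid, map_tmul, tmul_mul_tmul,
          includeLeft_apply, tmul_mul_tmul, one_mul, mul_assoc]
        rfl

theorem mulRight_one_tmul (y : TreeAlg ⊗[ℂ] TreeAlg) : mulRight (1 ⊗ₜ y) = insertLeft y := by
  induction y with
  | zero => simp
  | add p q hp hq => simp only [map_add, TensorProduct.tmul_add, hp, hq]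
  | tmul e f =>
    rw [Algebra.TensorProduct.one_def, mulRight_tmul, one_mul]
    rfl

/-- The co-product dual to the under product is a morphism for the co-action `δ^α`. -/
theorem underTensorId_treeCoaction (t : PBT) :
    underTensorId (treeCoaction t) =
      mulRight (TensorProduct.map coactionLin coactionLin (underComul t)) := by
  induction t with
  | nil =>
    rw [underComul, treeCoaction_nil, underTensorId, TensorProduct.map_tmul,
      TensorProduct.map_tmul, underLin_tree, coactionLin_tree, underComul, treeCoaction_nil,
      mulRight_tmul, tree_nil, mul_one]
    rfl
  | node _ r s _ hs =>
    -- Since δ(r / V(u)) = Δ(r) (V ⊗ Id)δ(u), the factor Δ r comes out on the left with its right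
    -- leg in the last slot, in the correct order although the over product is not commutative.
    have h1 : ∀ y : TreeAlg ⊗[ℂ] TreeAlg,
        mulRight (TensorProduct.map coactionLin coactionLin ((tree r ⊗ₜ 1) * VTensorId y)) =
        insertMid (treeComul r) * VTensorIdId (mulRight
          (TensorProduct.map coactionLin coactionLin y)) := by
      intro y
      induction y with
      | zero => simp
      | add p q hp hq => simp only [map_add, mul_add, hp, hq]
      | tmul u v =>
        rw [VTensorId_tmul, tmul_mul_tmul, one_mul, TensorProduct.map_tmul,
          coactionLin_mul_linV, comulHom_tree, mulRight_mul_VTensorId, TensorProduct.map_tmul]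
    rw [underComul_node, map_add, map_add, h1, ← hs, TensorProduct.map_tmul, coactionLin_tree]
    have h2 : coactionLin 1 = 1 := coactionLin_tree .nil
    rw [h2, mulRight_one_tmul, treeCoaction_node, treeCoaction_V, underTensorId_mul_VTensorId]

theorem treeCounit_tensor_underComul (t : PBT) :
    map treeCounit (AlgHom.id ℂ TreeAlg) (underComul t) = 1 ⊗ₜ tree t := by
  cases t with
  | nil => rw [underComul, map_tmul, tree_nil, map_one]; rfl
  | node _ r s =>
    rw [underComul_node, map_add, map_mul, treeCounit_tensor_VTensorId, mul_zero, add_zero,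
      map_tmul, map_one, AlgHom.id_apply]

theorem tensor_treeCounit_underComul (t : PBT) :
    map (AlgHom.id ℂ TreeAlg) treeCounit (underComul t) = tree t ⊗ₜ 1 := by
  induction t with
  | nil => rw [underComul, map_tmul, tree_nil, map_one treeCounit]; rfl
  | node _ r s _ hs =>
    rw [underComul_node, map_add, map_mul, tensor_treeCounit_VTensorId, hs, map_tmul,
      treeCounit_tree, if_neg (by simp), TensorProduct.tmul_zero, zero_add, map_tmul, map_one,
      TensorProduct.map_tmul, linV_tree, tmul_mul_tmul, AlgHom.id_apply, tree_mul_V, one_mul]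
    rfl

end Under

/-! ### The Hopf algebra `H^α ⋉ H^e` -/

section QED

open Algebra.TensorProduct

set_option maxSynthPendingDepth 6

theorem toHe_tree (t : PBT) : toHe (tree t) = treeGen t := linearExt_tree _ t

theorem treeGen_coe (t : {t : PBT // t ≠ .nil}) : treeGen t = FreeAlgebra.ι ℂ t := by
  obtain ⟨t, ht⟩ := t
  cases t with
  | nil => exact absurd rfl ht
  | node _ r s => rfl

theorem eComul_treeGen (t : PBT) :
    eComul (treeGen t) = TensorProduct.map toHe toHe (underComul t) := by
  cases t with
  | nil => rw [underComul, TensorProduct.map_tmul, toHe_tree, treeGen, map_one]; rfl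
  | node _ r s => rw [treeGen, eComul, FreeAlgebra.lift_ι_apply]

theorem eCoaction_treeGen (t : PBT) :
    eCoaction (treeGen t) = TensorProduct.map toHe toHalpha.toLinearMap (treeCoaction t) := by
  cases t with
  | nil =>
    rw [treeCoaction_nil, TensorProduct.map_tmul, toHe_tree, treeGen, map_one, tree_nil,
      AlgHom.toLinearMap_apply, map_one]
    rfl
  | node _ r s => rw [treeGen, eCoaction, FreeAlgebra.lift_ι_apply]

/-- `toHe` is only linear, but this is enough to carry to H^e the tree identities, which are linear;
multiplicativity in H^e then leaves only generators to check. -/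
theorem eComul_toHe (x : TreeAlg) :
    eComul (toHe x) = TensorProduct.map toHe toHe (underLin x) := by
  induction x using treeAlg_induction with
  | tree t => rw [toHe_tree, eComul_treeGen, underLin_tree]
  | add x y hx hy => simp only [map_add, hx, hy]
  | smul c x hx => simp only [map_smul, hx]

theorem eCoaction_toHe (x : TreeAlg) :
    eCoaction (toHe x) = TensorProduct.map toHe toHalpha.toLinearMap (coactionLin x) := by
  induction x using treeAlg_induction with
  | tree t => rw [toHe_tree, eCoaction_treeGen, coactionLin_tree]
  | add x y hx hy => simp only [map_add, hx, hy]
  | smul c x hx => simp only [map_smul, hx]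

theorem eCounit_toHe (x : TreeAlg) : eCounit (toHe x) = treeCounit x := by
  induction x using treeAlg_induction with
  | tree t =>
    rw [toHe_tree, treeCounit_tree]
    cases t <;> simp [treeGen, eCounit]
  | add x y hx hy => simp only [map_add, hx, hy]
  | smul c x hx => simp only [map_smul, hx]

theorem alphaComul_toHalpha (x : TreeAlg) :
    alphaComul (toHalpha x) = map toHalpha toHalpha (comulHom x) := by
  induction x using treeAlg_induction with
  | tree t =>
    rw [toHalpha_tree, comulHom_tree]
    induction t with
    | nil => rw [treeClass, treeComul_nil, tree_nil_tmul, map_one, map_one]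
    | node _ r s hr _ =>
      rw [treeClass, map_mul, hr, treeComul_node, map_mul, alphaComul, MvPolynomial.aeval_X]
  | add x y hx hy => simp only [map_add, hx, hy]
  | smul c x hx => simp only [map_smul, hx]

theorem X_eq_toHalpha (s : PBT) : (MvPolynomial.X s : Halpha) = toHalpha (tree (V s)) := by
  rw [toHalpha_tree, V, treeClass, treeClass, one_mul]

theorem alpha_coassoc : (Algebra.TensorProduct.assoc ℂ ℂ ℂ Halpha Halpha Halpha).toAlgHom.comp
      ((map alphaComul (AlgHom.id ℂ Halpha)).comp alphaComul) =
    (map (AlgHom.id ℂ Halpha) alphaComul).comp alphaComul := by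
  have h1 : ∀ w : TreeAlg ⊗[ℂ] TreeAlg,
      Algebra.TensorProduct.assoc ℂ ℂ ℂ Halpha Halpha Halpha
        (map alphaComul (AlgHom.id ℂ Halpha) (map toHalpha toHalpha w)) =
      map toHalpha (map toHalpha toHalpha) (comulTensorId w) := by
    intro w
    induction w with
    | zero => simp
    | add p q hp hq => simp only [map_add, hp, hq]
    | tmul x y =>
      rw [map_tmul, map_tmul, alphaComul_toHalpha, comulTensorId_tmul]
      generalize comulHom x = z
      induction z with
      | zero => simp
      | add p q hp hq => simp only [map_add, TensorProduct.add_tmul, hp, hq]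
      | tmul a b => rfl
  have h2 : ∀ w : TreeAlg ⊗[ℂ] TreeAlg,
      map (AlgHom.id ℂ Halpha) alphaComul (map toHalpha toHalpha w) =
      map toHalpha (map toHalpha toHalpha) (idTensorComul w) := by
    intro w
    induction w with
    | zero => simp
    | add p q hp hq => simp only [map_add, hp, hq]
    | tmul x y =>
      rw [map_tmul, map_tmul, alphaComul_toHalpha, idTensorComul_tmul]
      rfl
  apply MvPolynomial.algHom_ext
  intro s
  simp only [AlgHom.comp_apply]
  rw [X_eq_toHalpha, alphaComul_toHalpha, comulHom_tree, h2, ← (tree_coassoc (V s)).1]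
  exact h1 _

theorem alpha_rTensor : (map alphaCounit (AlgHom.id ℂ Halpha)).comp alphaComul =
    (Algebra.TensorProduct.lid ℂ Halpha).symm := by
  have h1 : ∀ w : TreeAlg ⊗[ℂ] TreeAlg,
      map alphaCounit (AlgHom.id ℂ Halpha) (map toHalpha toHalpha w) =
      map (AlgHom.id ℂ ℂ) toHalpha (map treeCounit (AlgHom.id ℂ TreeAlg) w) := by
    intro w
    induction w with
    | zero => simp
    | add p q hp hq => simp only [map_add, hp, hq]
    | tmul x y => rfl
  apply MvPolynomial.algHom_ext
  intro s
  rw [AlgHom.comp_apply, X_eq_toHalpha, alphaComul_toHalpha, comulHom_tree, h1,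
    treeCounit_tensor_treeComul]
  rfl

theorem alpha_lTensor : (map (AlgHom.id ℂ Halpha) alphaCounit).comp alphaComul =
    (Algebra.TensorProduct.rid ℂ ℂ Halpha).symm := by
  have h1 : ∀ w : TreeAlg ⊗[ℂ] TreeAlg,
      map (AlgHom.id ℂ Halpha) alphaCounit (map toHalpha toHalpha w) =
      map toHalpha (AlgHom.id ℂ ℂ) (map (AlgHom.id ℂ TreeAlg) treeCounit w) := by
    intro w
    induction w with
    | zero => simp
    | add p q hp hq => simp only [map_add, hp, hq]
    | tmul x y => rfl
  apply MvPolynomial.algHom_ext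
  intro s
  rw [AlgHom.comp_apply, X_eq_toHalpha, alphaComul_toHalpha, comulHom_tree, h1,
    (tensor_treeCounit _).1]
  rfl

theorem e_coassoc : (Algebra.TensorProduct.assoc ℂ ℂ ℂ He He He).toAlgHom.comp
      ((map eComul (AlgHom.id ℂ He)).comp eComul) =
    (map (AlgHom.id ℂ He) eComul).comp eComul := by
  have h1 : ∀ w : TreeAlg ⊗[ℂ] TreeAlg,
      Algebra.TensorProduct.assoc ℂ ℂ ℂ He He He
        (map eComul (AlgHom.id ℂ He) (TensorProduct.map toHe toHe w)) =
      TensorProduct.map toHe (TensorProduct.map toHe toHe)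
        (Algebra.TensorProduct.assoc ℂ ℂ ℂ TreeAlg TreeAlg TreeAlg (underTensorId w)) := by
    intro w
    induction w with
    | zero => simp
    | add p q hp hq => simp only [map_add, hp, hq]
    | tmul x y =>
      rw [TensorProduct.map_tmul, map_tmul, eComul_toHe, underTensorId, TensorProduct.map_tmul]
      generalize underLin x = z
      induction z with
      | zero => simp
      | add p q hp hq => simp only [map_add, TensorProduct.add_tmul, hp, hq]
      | tmul a b => rfl
  have h2 : ∀ w : TreeAlg ⊗[ℂ] TreeAlg,
      map (AlgHom.id ℂ He) eComul (TensorProduct.map toHe toHe w) =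
      TensorProduct.map toHe (TensorProduct.map toHe toHe)
        (TensorProduct.map LinearMap.id underLin w) := by
    intro w
    induction w with
    | zero => simp
    | add p q hp hq => simp only [map_add, hp, hq]
    | tmul x y =>
      rw [TensorProduct.map_tmul, map_tmul, eComul_toHe]
      rfl
  apply FreeAlgebra.hom_ext
  funext t
  simp only [Function.comp_apply, AlgHom.comp_apply]
  rw [← treeGen_coe, eComul_treeGen, h2, ← under_coassoc]
  exact h1 _

theorem e_rTensor : (map eCounit (AlgHom.id ℂ He)).comp eComul =
    (Algebra.TensorProduct.lid ℂ He).symm := by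
  have h1 : ∀ w : TreeAlg ⊗[ℂ] TreeAlg,
      map eCounit (AlgHom.id ℂ He) (TensorProduct.map toHe toHe w) =
      TensorProduct.map LinearMap.id toHe (map treeCounit (AlgHom.id ℂ TreeAlg) w) := by
    intro w
    induction w with
    | zero => simp
    | add p q hp hq => simp only [map_add, hp, hq]
    | tmul x y =>
      rw [TensorProduct.map_tmul, map_tmul, eCounit_toHe]
      rfl
  apply FreeAlgebra.hom_ext
  funext t
  simp only [Function.comp_apply, AlgHom.comp_apply]
  rw [← treeGen_coe, eComul_treeGen, h1, treeCounit_tensor_underComul, TensorProduct.map_tmul,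
    toHe_tree]
  rfl

theorem e_lTensor : (map (AlgHom.id ℂ He) eCounit).comp eComul =
    (Algebra.TensorProduct.rid ℂ ℂ He).symm := by
  have h1 : ∀ w : TreeAlg ⊗[ℂ] TreeAlg,
      map (AlgHom.id ℂ He) eCounit (TensorProduct.map toHe toHe w) =
      TensorProduct.map toHe LinearMap.id (map (AlgHom.id ℂ TreeAlg) treeCounit w) := by
    intro w
    induction w with
    | zero => simp
    | add p q hp hq => simp only [map_add, hp, hq]
    | tmul x y =>
      rw [TensorProduct.map_tmul, map_tmul, eCounit_toHe]
      rfl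
  apply FreeAlgebra.hom_ext
  funext t
  simp only [Function.comp_apply, AlgHom.comp_apply]
  rw [← treeGen_coe, eComul_treeGen, h1, tensor_treeCounit_underComul, TensorProduct.map_tmul,
    toHe_tree]
  rfl

theorem eCoaction_coassoc : (Algebra.TensorProduct.assoc ℂ ℂ ℂ He Halpha Halpha).toAlgHom.comp
      ((map eCoaction (AlgHom.id ℂ Halpha)).comp eCoaction) =
    (map (AlgHom.id ℂ He) alphaComul).comp eCoaction := by
  have h1 : ∀ w : TreeAlg ⊗[ℂ] TreeAlg,
      Algebra.TensorProduct.assoc ℂ ℂ ℂ He Halpha Halpha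
        (map eCoaction (AlgHom.id ℂ Halpha) (TensorProduct.map toHe toHalpha.toLinearMap w)) =
      TensorProduct.map toHe (map toHalpha toHalpha).toLinearMap (coactionTensorId w) := by
    intro w
    induction w with
    | zero => simp
    | add p q hp hq => simp only [map_add, hp, hq]
    | tmul x y =>
      rw [TensorProduct.map_tmul, map_tmul, eCoaction_toHe, coactionTensorId_tmul]
      generalize coactionLin x = z
      induction z with
      | zero => simp
      | add p q hp hq => simp only [map_add, TensorProduct.add_tmul, hp, hq]
      | tmul a b => rfl
  have h2 : ∀ w : TreeAlg ⊗[ℂ] TreeAlg,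
      map (AlgHom.id ℂ He) alphaComul (TensorProduct.map toHe toHalpha.toLinearMap w) =
      TensorProduct.map toHe (map toHalpha toHalpha).toLinearMap (idTensorComul w) := by
    intro w
    induction w with
    | zero => simp
    | add p q hp hq => simp only [map_add, hp, hq]
    | tmul x y =>
      rw [TensorProduct.map_tmul, map_tmul, AlgHom.toLinearMap_apply, alphaComul_toHalpha]
      rfl
  apply FreeAlgebra.hom_ext
  funext t
  simp only [Function.comp_apply, AlgHom.comp_apply]
  rw [← treeGen_coe, eCoaction_treeGen, h2, ← (tree_coassoc _).2]
  exact h1 _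

theorem eCoaction_counit (b : He) :
    map (AlgHom.id ℂ He) alphaCounit (eCoaction b) = b ⊗ₜ 1 := by
  have h1 : ∀ w : TreeAlg ⊗[ℂ] TreeAlg,
      map (AlgHom.id ℂ He) alphaCounit (TensorProduct.map toHe toHalpha.toLinearMap w) =
      TensorProduct.map toHe LinearMap.id (map (AlgHom.id ℂ TreeAlg) treeCounit w) := by
    intro w
    induction w with
    | zero => simp
    | add p q hp hq => simp only [map_add, hp, hq]
    | tmul x y => rfl
  have : (map (AlgHom.id ℂ He) alphaCounit).comp eCoaction = includeLeft := by
    apply FreeAlgebra.hom_ext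
    funext t
    simp only [Function.comp_apply, AlgHom.comp_apply]
    rw [← treeGen_coe, eCoaction_treeGen, h1, (tensor_treeCounit _).2, TensorProduct.map_tmul,
      toHe_tree]
    rfl
  exact DFunLike.congr_fun this b

theorem eCounit_coaction (b : He) :
    map eCounit (AlgHom.id ℂ Halpha) (eCoaction b) = eCounit b ⊗ₜ 1 := by
  have h1 : ∀ w : TreeAlg ⊗[ℂ] TreeAlg,
      map eCounit (AlgHom.id ℂ Halpha) (TensorProduct.map toHe toHalpha.toLinearMap w) =
      map (AlgHom.id ℂ ℂ) toHalpha (map treeCounit (AlgHom.id ℂ TreeAlg) w) := by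
    intro w
    induction w with
    | zero => simp
    | add p q hp hq => simp only [map_add, hp, hq]
    | tmul x y =>
      rw [TensorProduct.map_tmul, map_tmul, eCounit_toHe]
      rfl
  have : (map eCounit (AlgHom.id ℂ Halpha)).comp eCoaction =
      (includeLeft : ℂ →ₐ[ℂ] ℂ ⊗[ℂ] Halpha).comp eCounit := by
    apply FreeAlgebra.hom_ext
    funext t
    simp only [Function.comp_apply, AlgHom.comp_apply]
    rw [← treeGen_coe, eCoaction_treeGen, h1, treeCounit_tensor_treeCoaction, map_tmul, map_one,
      ← toHe_tree, eCounit_toHe]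
    rfl
  exact DFunLike.congr_fun this b

/-- Both sides are algebra homomorphisms, the right one because H^α is commutative, so the identity
is needed only on trees, where it is `underTensorId_treeCoaction`. -/
theorem eComul_coaction : (map eComul (AlgHom.id ℂ Halpha)).comp eCoaction =
    (coactionMul Halpha He).comp ((map eCoaction eCoaction).comp eComul) := by
  have h1 : ∀ w : TreeAlg ⊗[ℂ] TreeAlg,
      map eComul (AlgHom.id ℂ Halpha) (TensorProduct.map toHe toHalpha.toLinearMap w) =
      TensorProduct.map (TensorProduct.map toHe toHe) toHalpha.toLinearMap (underTensorId w) := by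
    intro w
    induction w with
    | zero => simp
    | add p q hp hq => simp only [map_add, hp, hq]
    | tmul x y =>
      rw [TensorProduct.map_tmul, map_tmul, eComul_toHe]
      rfl
  have h2 : ∀ w : TreeAlg ⊗[ℂ] TreeAlg,
      coactionMul Halpha He (map eCoaction eCoaction (TensorProduct.map toHe toHe w)) =
      TensorProduct.map (TensorProduct.map toHe toHe) toHalpha.toLinearMap
        (mulRight (TensorProduct.map coactionLin coactionLin w)) := by
    intro w
    induction w with
    | zero => simp
    | add p q hp hq => simp only [map_add, hp, hq]
    | tmul x y =>
      rw [TensorProduct.map_tmul, map_tmul, eCoaction_toHe, eCoaction_toHe,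
        TensorProduct.map_tmul]
      generalize coactionLin x = u
      generalize coactionLin y = v
      induction u with
      | zero => simp
      | add p q hp hq => simp only [map_add, TensorProduct.add_tmul, hp, hq]
      | tmul a b =>
        induction v with
        | zero => simp
        | add p q hp hq => simp only [map_add, TensorProduct.tmul_add, hp, hq]
        | tmul c d =>
          rw [TensorProduct.map_tmul, TensorProduct.map_tmul, coactionMul_tmul, mulRight_tmul,
            TensorProduct.map_tmul, TensorProduct.map_tmul, AlgHom.toLinearMap_apply,
            AlgHom.toLinearMap_apply, AlgHom.toLinearMap_apply, map_mul]
  apply FreeAlgebra.hom_ext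
  funext t
  simp only [Function.comp_apply, AlgHom.comp_apply]
  rw [← treeGen_coe, eCoaction_treeGen, h1, eComul_treeGen, h2, underTensorId_treeCoaction]

end QED

/-! ### Leading terms of the structure maps on trees -/

section Leading

open Algebra.TensorProduct

/-- The span of the trees with less than `n` internal vertices. -/
def treesLT (n : ℕ) : Submodule ℂ TreeAlg := Submodule.span ℂ (tree '' {t | t.numNodes < n})

theorem tree_mem_treesLT {t : PBT} {n : ℕ} (h : t.numNodes < n) : tree t ∈ treesLT n :=
  Submodule.subset_span ⟨t, h, rfl⟩

theorem treesLT_mono {m n : ℕ} (h : m ≤ n) : treesLT m ≤ treesLT n :=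
  Submodule.span_mono (Set.image_mono fun _ ht => lt_of_lt_of_le ht h)

theorem numNodes_overProd (t s : PBT) :
    (overProd t s).numNodes = t.numNodes + s.numNodes := by
  induction s with
  | nil => rfl
  | node _ r s hr _ => simp only [overProd, BinaryTree.numNodes, hr]; omega

/-- Vertices add under the over product and both bounds are strict, which gains one unit: (m - 1) +
(n - 1) < k. -/
theorem mul_mem_treesLT {m n k : ℕ} (h : m + n ≤ k + 1) {x y : TreeAlg} (hx : x ∈ treesLT m)
    (hy : y ∈ treesLT n) : x * y ∈ treesLT k := by
  induction hx using Submodule.span_induction with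
  | zero => simp
  | add x x' _ _ h1 h2 => rw [add_mul]; exact add_mem h1 h2
  | smul c x _ h1 => rw [smul_mul_assoc]; exact Submodule.smul_mem _ _ h1
  | mem x hx =>
    obtain ⟨t, ht, rfl⟩ := hx
    induction hy using Submodule.span_induction with
    | zero => simp
    | add x x' _ _ h1 h2 => rw [mul_add]; exact add_mem h1 h2
    | smul c x _ h1 => rw [mul_smul_comm]; exact Submodule.smul_mem _ _ h1
    | mem y hy =>
      obtain ⟨s, hs, rfl⟩ := hy
      rw [tree_mul]
      refine tree_mem_treesLT ?_
      rw [numNodes_overProd]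
      simp only [Set.mem_ofPred_eq] at ht hs
      omega

theorem linV_mem_treesLT {n : ℕ} {x : TreeAlg} (hx : x ∈ treesLT n) : linV x ∈ treesLT (n + 1) := by
  induction hx using Submodule.span_induction with
  | zero => simp
  | add x x' _ _ h1 h2 => rw [map_add]; exact add_mem h1 h2
  | smul c x _ h1 => rw [map_smul]; exact Submodule.smul_mem _ _ h1
  | mem x hx =>
    obtain ⟨t, ht, rfl⟩ := hx
    rw [linV_tree]
    refine tree_mem_treesLT ?_
    simp only [Set.mem_ofPred_eq] at ht
    simp only [V, BinaryTree.numNodes]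
    omega

/-- The tensors whose left factors are trees with less than `n` internal vertices. -/
def tensorLT (n : ℕ) : Submodule ℂ (TreeAlg ⊗[ℂ] TreeAlg) :=
  LinearMap.range ((treesLT n).subtype.rTensor TreeAlg)

theorem VTensorId_mem_tensorLT {n : ℕ} {z : TreeAlg ⊗[ℂ] TreeAlg} (hz : z ∈ tensorLT n) :
    VTensorId z ∈ tensorLT (n + 1) := by
  obtain ⟨w, rfl⟩ := hz
  induction w with
  | zero => simp
  | add p q hp hq => rw [map_add, map_add]; exact add_mem hp hq
  | tmul p q => exact tmul_mem_range_rTensor (linV_mem_treesLT p.2) q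

/-- Elements of `T ⊗ T` with leading term `t ⊗ 1`. -/
def HasLeading (t : PBT) (w : TreeAlg ⊗[ℂ] TreeAlg) : Prop :=
  ∃ z ∈ tensorLT t.numNodes, w = tree t ⊗ₜ 1 + z

theorem HasLeading.VTensorId {t : PBT} {w : TreeAlg ⊗[ℂ] TreeAlg} (h : HasLeading t w) :
    HasLeading (V t) (VTensorId w) := by
  obtain ⟨z, hz, rfl⟩ := h
  refine ⟨_, ?_, by rw [map_add, VTensorId_tmul, linV_tree]⟩
  have := VTensorId_mem_tensorLT hz
  simpa only [V, BinaryTree.numNodes, zero_add] using this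

/-- The root tree has no vertices, so 1 ⊗ x is a lower term as soon as t is not the root tree. -/
theorem HasLeading.one_tmul_add {t : PBT} (ht : t ≠ .nil) {w : TreeAlg ⊗[ℂ] TreeAlg}
    (h : HasLeading t w) (x : TreeAlg) : HasLeading t (1 ⊗ₜ x + w) := by
  obtain ⟨z, hz, rfl⟩ := h
  refine ⟨1 ⊗ₜ x + z, add_mem (tmul_mem_range_rTensor (tree_mem_treesLT (t := .nil) ?_) x) hz,
    by abel⟩
  cases t with
  | nil => exact absurd rfl ht
  | node _ r s => simp only [BinaryTree.numNodes]; omega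

theorem HasLeading.mul {t s : PBT} {w y : TreeAlg ⊗[ℂ] TreeAlg} (hw : HasLeading t w)
    (hy : HasLeading s y) : HasLeading (overProd t s) (w * y) := by
  obtain ⟨z, hz, rfl⟩ := hw
  obtain ⟨z', hz', rfl⟩ := hy
  refine ⟨(tree t ⊗ₜ 1) * z' + z * (tree s ⊗ₜ 1) + z * z', ?_, ?_⟩
  · rw [numNodes_overProd]
    refine add_mem (add_mem ?_ ?_) ?_
    · exact mul_mem_range_rTensor (fun x hx y hy => mul_mem_treesLT (by omega) hx hy)
        (tmul_mem_range_rTensor (tree_mem_treesLT (Nat.lt_succ_self _)) 1) hz'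
    · exact mul_mem_range_rTensor (fun x hx y hy => mul_mem_treesLT (by omega) hx hy) hz
        (tmul_mem_range_rTensor (tree_mem_treesLT (Nat.lt_succ_self _)) 1)
    · exact mul_mem_range_rTensor (fun x hx y hy => mul_mem_treesLT (by omega) hx hy) hz hz'
  · rw [← tree_mul, add_mul, mul_add, mul_add, tmul_mul_tmul, mul_one]
    abel

theorem overProd_V (t s : PBT) : overProd t (V s) = .node () t s := rfl

theorem HasLeading.mul_V {t s : PBT} {w y : TreeAlg ⊗[ℂ] TreeAlg} (hw : HasLeading t w)
    (hy : HasLeading (V s) y) : HasLeading (.node () t s) (w * y) := by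
  rw [← overProd_V]
  exact hw.mul hy

theorem hasLeading_nil : HasLeading .nil 1 := ⟨0, zero_mem _, by rw [add_zero]; rfl⟩

/-- Leading terms are stable under V and under the over product, hence under the recursion that
defines both maps. -/
theorem hasLeading_treeComul_treeCoaction (t : PBT) :
    HasLeading t (treeComul t) ∧ HasLeading t (treeCoaction t) := by
  induction t with
  | nil => exact ⟨hasLeading_nil, hasLeading_nil⟩
  | node _ r s hr hs =>
    have hV : HasLeading (V s) (treeCoaction (V s)) := by
      rw [treeCoaction_V]; exact hs.2.VTensorId
    rw [treeComul_node, treeCoaction_node, treeComul_V]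
    exact ⟨hr.1.mul_V (hV.one_tmul_add (by simp [V]) _), hr.1.mul_V hV⟩

theorem hasLeading_underComul (t : PBT) : HasLeading t (underComul t) := by
  induction t with
  | nil => exact hasLeading_nil
  | node _ r s _ hs =>
    rw [underComul_node]
    have hr : HasLeading r (tree r ⊗ₜ 1) := ⟨0, zero_mem _, (add_zero _).symm⟩
    exact (hr.mul_V hs.VTensorId).one_tmul_add (by simp) _

theorem coactionLin_mem_tensorLT {n : ℕ} {x : TreeAlg} (hx : x ∈ treesLT n) :
    coactionLin x ∈ tensorLT n := by
  induction hx using Submodule.span_induction with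
  | zero => simp
  | add x x' _ _ h1 h2 => rw [map_add]; exact add_mem h1 h2
  | smul c x _ h1 => rw [map_smul]; exact Submodule.smul_mem _ _ h1
  | mem x hx =>
    obtain ⟨t, ht, rfl⟩ := hx
    rw [coactionLin_tree]
    obtain ⟨z, hz, h⟩ := (hasLeading_treeComul_treeCoaction t).2
    rw [h]
    exact add_mem (tmul_mem_range_rTensor (tree_mem_treesLT ht) 1)
      (range_rTensor_mono (treesLT_mono (le_of_lt ht)) hz)

theorem map_mem_range_rTensor {A : Type} [Ring A] [Algebra ℂ A] {C : Submodule ℂ A}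
    {f g : TreeAlg →ₗ[ℂ] A} {n : ℕ} (h : ∀ t : PBT, t.numNodes < n → f (tree t) ∈ C)
    {w : TreeAlg ⊗[ℂ] TreeAlg} (hw : w ∈ tensorLT n) :
    TensorProduct.map f g w ∈ LinearMap.range (C.subtype.rTensor A) := by
  obtain ⟨z, rfl⟩ := hw
  induction z with
  | zero => simp
  | add p q hp hq => rw [map_add, map_add]; exact add_mem hp hq
  | tmul p q =>
    refine tmul_mem_range_rTensor ?_ _
    have : treesLT n ≤ C.comap f := Submodule.span_le.2 (by rintro _ ⟨t, ht, rfl⟩; exact h t ht)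
    exact this p.2

end Leading

/-! ### The antipode of `H^α ⋉ H^e` -/

/-- A subalgebra of the tensor product of a polynomial ring and a free algebra is everything as
soon as it contains the generators. -/
theorem subalgebra_tensor_eq_top {σ τ : Type}
    {C : Subalgebra ℂ (MvPolynomial σ ℂ ⊗[ℂ] FreeAlgebra ℂ τ)}
    (hl : ∀ i, MvPolynomial.X i ⊗ₜ[ℂ] (1 : FreeAlgebra ℂ τ) ∈ C)
    (hr : ∀ i, (1 : MvPolynomial σ ℂ) ⊗ₜ[ℂ] FreeAlgebra.ι ℂ i ∈ C) : C = ⊤ := by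
  have h1 : ∀ x : MvPolynomial σ ℂ, x ⊗ₜ[ℂ] (1 : FreeAlgebra ℂ τ) ∈ C := by
    intro x
    have : Algebra.adjoin ℂ (Set.range (MvPolynomial.X : σ → MvPolynomial σ ℂ)) ≤
        C.comap (Algebra.TensorProduct.includeLeft : _ →ₐ[ℂ] _) :=
      Algebra.adjoin_le (by rintro _ ⟨i, rfl⟩; exact hl i)
    rw [MvPolynomial.adjoin_range_X] at this
    exact this trivial
  have h2 : ∀ y : FreeAlgebra ℂ τ, (1 : MvPolynomial σ ℂ) ⊗ₜ[ℂ] y ∈ C := by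
    intro y
    have : Algebra.adjoin ℂ (Set.range (FreeAlgebra.ι ℂ : τ → FreeAlgebra ℂ τ)) ≤
        C.comap (Algebra.TensorProduct.includeRight : _ →ₐ[ℂ] _) :=
      Algebra.adjoin_le (by rintro _ ⟨i, rfl⟩; exact hr i)
    rw [FreeAlgebra.adjoin_range_ι] at this
    exact this trivial
  refine eq_top_iff.2 fun z _ => ?_
  induction z with
  | zero => exact zero_mem _
  | add p q hp hq => exact add_mem (hp trivial) (hq trivial)
  | tmul x y =>
    have : x ⊗ₜ[ℂ] y = (x ⊗ₜ 1) * (1 ⊗ₜ y) := by simp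
    rw [this]
    exact mul_mem (h1 x) (h2 y)

section QEDAntipode

open Algebra.TensorProduct

theorem qedComul_toHalpha (x : TreeAlg) : qedComul (toHalpha x ⊗ₜ 1) =
    TensorProduct.map
      ((includeLeft : Halpha →ₐ[ℂ] QEDSmash).toLinearMap ∘ₗ toHalpha.toLinearMap)
      ((includeLeft : Halpha →ₐ[ℂ] QEDSmash).toLinearMap ∘ₗ toHalpha.toLinearMap)
      (comulHom x) := by
  rw [qedComul, smashComul_tmul_one, smashLeft, AlgHom.comp_apply, alphaComul_toHalpha]
  generalize comulHom x = w
  induction w with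
  | zero => simp
  | add p q hp hq => simp only [map_add, hp, hq]
  | tmul a b => rfl

/-- `(δ ⊗ Id)` on trees, read in the square of `H^α ⋉ H^e`. -/
theorem smashEmb_eCoaction_toHe (x y : TreeAlg) :
    smashEmb Halpha He (eCoaction (toHe x) ⊗ₜ toHe y) =
      TensorProduct.map ((includeRight : He →ₐ[ℂ] QEDSmash).toLinearMap ∘ₗ toHe)
        ((TensorProduct.mk ℂ Halpha He).flip (toHe y) ∘ₗ toHalpha.toLinearMap)
        (coactionLin x) := by
  rw [eCoaction_toHe]
  generalize coactionLin x = w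
  induction w with
  | zero => simp
  | add p q hp hq => simp only [map_add, TensorProduct.add_tmul, hp, hq]
  | tmul a b => rfl

/-- Induction on the number of vertices: the leading terms of Δ^α, δ^α and the under co-product show
that each generator x satisfies Δ x = x ⊗ 1 + (terms with smaller trees on the left). -/
theorem qed_conil (C : Subalgebra ℂ QEDSmash)
    (hC : ∀ x, ∀ z ∈ LinearMap.range (C.toSubmodule.subtype.rTensor QEDSmash),
      qedComul x = x ⊗ₜ[ℂ] 1 + z → x ∈ C) : C = ⊤ := by
  have hl : ∀ n, ∀ t : PBT, t.numNodes < n → toHalpha (tree t) ⊗ₜ[ℂ] (1 : He) ∈ C := by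
    intro n
    induction n with
    | zero => intro t ht; omega
    | succ n ih =>
      intro t ht
      obtain ⟨z, hz, h⟩ := (hasLeading_treeComul_treeCoaction t).1
      have hz' : z ∈ tensorLT n := range_rTensor_mono (treesLT_mono (by omega)) hz
      refine hC _ _ (map_mem_range_rTensor (C := C.toSubmodule)
        (f := (includeLeft : Halpha →ₐ[ℂ] QEDSmash).toLinearMap ∘ₗ toHalpha.toLinearMap)
        (g := (includeLeft : Halpha →ₐ[ℂ] QEDSmash).toLinearMap ∘ₗ toHalpha.toLinearMap)
        ih hz') ?_
      rw [qedComul_toHalpha, comulHom_tree, h, map_add, TensorProduct.map_tmul]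
      congr 2
      simp only [LinearMap.comp_apply, AlgHom.toLinearMap_apply, map_one]
  have hr : ∀ n, ∀ t : PBT, t.numNodes < n → (1 : Halpha) ⊗ₜ[ℂ] toHe (tree t) ∈ C := by
    intro n
    induction n with
    | zero => intro t ht; omega
    | succ n ih =>
      intro t ht
      have hle : t.numNodes ≤ n := by omega
      -- The left factors of Δ(1 ⊗ b) all lie in 1 ⊗ H^e, so this induction does not use `hl`.
      have hmem : ∀ (y : TreeAlg) {w : TreeAlg ⊗[ℂ] TreeAlg}, w ∈ tensorLT n →
          TensorProduct.map ((includeRight : He →ₐ[ℂ] QEDSmash).toLinearMap ∘ₗ toHe)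
            ((TensorProduct.mk ℂ Halpha He).flip (toHe y) ∘ₗ toHalpha.toLinearMap) w ∈
          LinearMap.range (C.toSubmodule.subtype.rTensor QEDSmash) := fun y w hw =>
        map_mem_range_rTensor (C := C.toSubmodule)
          (f := (includeRight : He →ₐ[ℂ] QEDSmash).toLinearMap ∘ₗ toHe) ih hw
      obtain ⟨z, hz, h⟩ := hasLeading_underComul t
      obtain ⟨z', hz', h'⟩ := (hasLeading_treeComul_treeCoaction t).2
      have h1 : smashEmb Halpha He (map eCoaction (AlgHom.id ℂ He)
          (TensorProduct.map toHe toHe z)) ∈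
          LinearMap.range (C.toSubmodule.subtype.rTensor QEDSmash) := by
        clear h
        obtain ⟨w, rfl⟩ := hz
        induction w with
        | zero => simp
        | add p q hp hq => simp only [map_add]; exact add_mem hp hq
        | tmul p q =>
          rw [LinearMap.rTensor_tmul, TensorProduct.map_tmul, map_tmul, AlgHom.id_apply,
            smashEmb_eCoaction_toHe]
          exact hmem q (range_rTensor_mono (treesLT_mono hle) (coactionLin_mem_tensorLT p.2))
      -- The remainder has two sources: the lower terms of δ t, and the image under δ ⊗ Id of the
      -- lower terms of the under co-product, whose left factors δ does not enlarge.
      refine hC _ _ (add_mem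
        (hmem (tree .nil) (range_rTensor_mono (treesLT_mono hle) hz')) h1) ?_
      rw [qedComul, smashComul_one_tmul, smashRight_apply, toHe_tree, eComul_treeGen, h, map_add,
        map_add, map_add, ← add_assoc]
      congr 1
      have h2 : (1 : TreeAlg) = tree .nil := rfl
      rw [TensorProduct.map_tmul, map_tmul, AlgHom.id_apply, h2, smashEmb_eCoaction_toHe,
        coactionLin_tree, h', map_add, TensorProduct.map_tmul]
      congr 2
      · simp only [LinearMap.comp_apply, AlgHom.toLinearMap_apply, toHe_tree]
        rfl
      · simp only [LinearMap.comp_apply, AlgHom.toLinearMap_apply, toHe_tree, map_one]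
        rfl
  refine subalgebra_tensor_eq_top (fun s => ?_) fun t => ?_
  · rw [X_eq_toHalpha]
    exact hl _ _ (Nat.lt_succ_self _)
  · rw [← treeGen_coe, ← toHe_tree]
    exact hr _ _ (Nat.lt_succ_self _)

theorem isHopf_qed : IsHopf qedComul qedCounit :=
  IsHopf.of_adjoin (smash_coassoc alpha_coassoc e_coassoc eCoaction_coassoc eComul_coaction)
    (smash_rTensor alpha_rTensor e_rTensor eCounit_coaction)
    (smash_lTensor alpha_lTensor e_lTensor eCoaction_counit) qed_conil

end QEDAntipode

/-! ### The structure maps on the sums of all trees of a given order -/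

section TreeSums

open Finset Algebra.TensorProduct

/-! ### Re-indexing of iterated sums over antidiagonals -/

theorem sum_antidiagonal_assoc {M : Type*} [AddCommMonoid M] (n : ℕ) (f : ℕ → ℕ → ℕ → M) :
    ∑ x ∈ antidiagonal n, ∑ y ∈ antidiagonal x.1, f y.1 y.2 x.2 =
      ∑ x ∈ antidiagonal n, ∑ y ∈ antidiagonal x.2, f x.1 y.1 y.2 := by
  rw [sum_sigma', sum_sigma']
  refine sum_nbij' (fun x => ⟨(x.2.1, x.2.2 + x.1.2), (x.2.2, x.1.2)⟩)
    (fun x => ⟨(x.1.1 + x.2.1, x.2.2), (x.1.1, x.2.1)⟩) ?_ ?_ ?_ ?_ ?_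
  · rintro ⟨⟨i, j⟩, k, l⟩ h
    simp only [mem_sigma, HasAntidiagonal.mem_antidiagonal, and_true] at h ⊢
    omega
  · rintro ⟨⟨i, j⟩, k, l⟩ h
    simp only [mem_sigma, HasAntidiagonal.mem_antidiagonal, and_true] at h ⊢
    omega
  · rintro ⟨⟨i, j⟩, k, l⟩ h
    simp only [mem_sigma, HasAntidiagonal.mem_antidiagonal] at h
    obtain ⟨-, rfl⟩ := h
    rfl
  · rintro ⟨⟨i, j⟩, k, l⟩ h
    simp only [mem_sigma, HasAntidiagonal.mem_antidiagonal] at h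
    obtain ⟨-, rfl⟩ := h
    rfl
  · rintro ⟨⟨i, j⟩, k, l⟩ _
    rfl

/-- Both sides run over the decompositions of n into four parts; the re-indexing exchanges the two
middle parts and is its own inverse. -/
theorem sum_antidiagonal_exchange {M : Type*} [AddCommMonoid M] (n : ℕ)
    (f : ℕ → ℕ → ℕ → ℕ → M) :
    ∑ x ∈ antidiagonal n, ∑ y ∈ antidiagonal x.1, ∑ z ∈ antidiagonal x.2, f y.1 y.2 z.1 z.2 =
      ∑ x ∈ antidiagonal n, ∑ y ∈ antidiagonal x.1, ∑ z ∈ antidiagonal x.2,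
        f y.1 z.1 y.2 z.2 := by
  simp only [← sum_product', sum_sigma']
  refine sum_nbij'
    (fun x => ⟨(x.2.1.1 + x.2.2.1, x.2.1.2 + x.2.2.2), (x.2.1.1, x.2.2.1), (x.2.1.2, x.2.2.2)⟩)
    (fun x => ⟨(x.2.1.1 + x.2.2.1, x.2.1.2 + x.2.2.2), (x.2.1.1, x.2.2.1), (x.2.1.2, x.2.2.2)⟩)
    ?_ ?_ ?_ ?_ ?_
  · rintro ⟨⟨i, j⟩, ⟨k, p⟩, l, q⟩ h
    simp only [mem_sigma, mem_product, HasAntidiagonal.mem_antidiagonal, and_true] at h ⊢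
    omega
  · rintro ⟨⟨i, j⟩, ⟨k, p⟩, l, q⟩ h
    simp only [mem_sigma, mem_product, HasAntidiagonal.mem_antidiagonal, and_true] at h ⊢
    omega
  · rintro ⟨⟨i, j⟩, ⟨k, p⟩, l, q⟩ h
    simp only [mem_sigma, mem_product, HasAntidiagonal.mem_antidiagonal] at h
    obtain ⟨-, rfl, rfl⟩ := h
    rfl
  · rintro ⟨⟨i, j⟩, ⟨k, p⟩, l, q⟩ h
    simp only [mem_sigma, mem_product, HasAntidiagonal.mem_antidiagonal] at h
    obtain ⟨-, rfl, rfl⟩ := h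
    rfl
  · rintro ⟨⟨i, j⟩, ⟨k, p⟩, l, q⟩ _
    rfl

theorem sum_treesOfNumNodesEq_succ {M : Type*} [AddCommMonoid M] (n : ℕ) (f : PBT → M) :
    ∑ t ∈ BinaryTree.treesOfNumNodesEq (n + 1), f t =
      ∑ x ∈ antidiagonal n, ∑ r ∈ BinaryTree.treesOfNumNodesEq x.1,
        ∑ s ∈ BinaryTree.treesOfNumNodesEq x.2, f (.node () r s) := by
  rw [BinaryTree.treesOfNumNodesEq_succ, sum_biUnion]
  · refine sum_congr rfl fun x _ => ?_
    rw [← sum_product', BinaryTree.pairwiseNode, sum_map]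
    rfl
  · rintro ⟨i, j⟩ _ ⟨k, l⟩ _ h
    refine disjoint_left.2 fun t h1 h2 => h ?_
    simp only [BinaryTree.pairwiseNode, mem_map, mem_product,
      BinaryTree.mem_treesOfNumNodesEq] at h1 h2
    obtain ⟨⟨r, s⟩, ⟨rfl, rfl⟩, rfl⟩ := h1
    obtain ⟨⟨r', s'⟩, ⟨rfl, rfl⟩, h2⟩ := h2
    obtain ⟨-, rfl, rfl⟩ := BinaryTree.node.inj h2
    rfl

/-! ### Recursion and structure maps for the sums of trees -/

theorem treeSum_zero : treeSum 0 = 1 := by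
  rw [treeSum, BinaryTree.treesOfNumNodesEq_zero, sum_singleton, tree_nil]

/-- The coefficients of T = 1 + x T V(T), by cutting each tree at its root. -/
theorem treeSum_succ (n : ℕ) :
    treeSum (n + 1) = ∑ x ∈ antidiagonal n, treeSum x.1 * linV (treeSum x.2) := by
  rw [treeSum, sum_treesOfNumNodesEq_succ]
  refine sum_congr rfl fun x _ => ?_
  simp only [treeSum, map_sum, sum_mul, mul_sum, linV_tree, tree_mul_V]
  exact sum_comm

theorem underLin_treeSum (n : ℕ) :
    underLin (treeSum n) = ∑ x ∈ antidiagonal n, treeSum x.1 ⊗ₜ treeSum x.2 := by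
  induction n using Nat.strong_induction_on with
  | _ n ih =>
    rcases n with _ | n
    · rw [treeSum_zero, underLin_one, Nat.antidiagonal_zero, sum_singleton, treeSum_zero]
      rfl
    have h1 : ∀ x ∈ antidiagonal n, underLin (treeSum x.1 * linV (treeSum x.2)) =
        1 ⊗ₜ (treeSum x.1 * linV (treeSum x.2)) + ∑ y ∈ antidiagonal x.2,
          (treeSum x.1 * linV (treeSum y.1)) ⊗ₜ treeSum y.2 := by
      intro x hx
      rw [HasAntidiagonal.mem_antidiagonal] at hx
      rw [underLin_mul_linV, ih x.2 (by omega), map_sum, mul_sum]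
      simp only [VTensorId_tmul, tmul_mul_tmul, one_mul]
    rw [treeSum_succ, map_sum, sum_congr rfl h1, sum_add_distrib, ← TensorProduct.tmul_sum,
      ← treeSum_succ, Nat.sum_antidiagonal_succ, treeSum_zero]
    congr 1
    rw [← sum_antidiagonal_assoc n (fun i j k => (treeSum i * linV (treeSum j)) ⊗ₜ treeSum k)]
    refine sum_congr rfl fun x _ => ?_
    rw [treeSum_succ, TensorProduct.sum_tmul]

/-- The generating series of the sums of trees. -/
def treeSeries : PowerSeries TreeAlg := PowerSeries.mk treeSum

theorem coeff_treeSeries (n : ℕ) : PowerSeries.coeff n treeSeries = treeSum n :=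
  PowerSeries.coeff_mk _ _

theorem coeff_zero_treeSeries_pow (k : ℕ) : PowerSeries.coeff 0 (treeSeries ^ k) = 1 := by
  rw [PowerSeries.coeff_zero_eq_constantCoeff_apply, map_pow,
    ← PowerSeries.coeff_zero_eq_constantCoeff_apply, coeff_treeSeries, treeSum_zero, one_pow]

/-- The equation T = 1 + x T V(T) multiplied on the left by T^k, where x is central. -/
theorem coeff_succ_treeSeries_pow_succ (k n : ℕ) :
    PowerSeries.coeff (n + 1) (treeSeries ^ (k + 1)) =
      PowerSeries.coeff (n + 1) (treeSeries ^ k) + ∑ x ∈ antidiagonal n,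
        PowerSeries.coeff x.1 (treeSeries ^ (k + 1)) * linV (treeSum x.2) := by
  have h : treeSeries = 1 + PowerSeries.X *
      (treeSeries * PowerSeries.mk fun n => linV (treeSum n)) := by
    ext n
    rcases n with _ | n
    · simp [coeff_treeSeries, treeSum_zero]
    · rw [map_add, PowerSeries.coeff_succ_X_mul, PowerSeries.coeff_mul, coeff_treeSeries,
        treeSum_succ, PowerSeries.coeff_one, if_neg n.succ_ne_zero, zero_add]
      simp only [coeff_treeSeries, PowerSeries.coeff_mk]
  have h2 : treeSeries ^ (k + 1) = treeSeries ^ k + PowerSeries.X *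
      (treeSeries ^ (k + 1) * PowerSeries.mk fun n => linV (treeSum n)) := by
    have h3 := congrArg (treeSeries ^ k * ·) h
    simp only [← pow_succ, mul_add, mul_one] at h3
    conv_lhs => rw [h3, ← mul_assoc, ← PowerSeries.X_mul, mul_assoc, ← mul_assoc (_ ^ k),
      ← pow_succ]
  conv_lhs => rw [h2, map_add, PowerSeries.coeff_succ_X_mul, PowerSeries.coeff_mul]
  simp only [PowerSeries.coeff_mk]

/-- Order n + 1 of δ uses both formulas at lower orders through δ(t_i / V(t_j)) = Δ(t_i) (V ⊗
Id)δ(t_j). Then Δ follows from Δ(x / V(y)) = δ(x / V(y)) + Δ(x)(1 ⊗ V(y)) and T^{k+1} = T^k + x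
T^{k+1} V(T). -/
theorem coactionLin_comulHom_treeSum (n : ℕ) :
    coactionLin (treeSum n) = ∑ x ∈ antidiagonal n,
        treeSum x.1 ⊗ₜ PowerSeries.coeff x.2 (treeSeries ^ x.1) ∧
      comulHom (treeSum n) = ∑ x ∈ antidiagonal n,
        treeSum x.1 ⊗ₜ PowerSeries.coeff x.2 (treeSeries ^ (x.1 + 1)) := by
  induction n using Nat.strong_induction_on with
  | _ n ih =>
    rcases n with _ | n
    · simp only [Nat.antidiagonal_zero, sum_singleton, treeSum_zero, coeff_zero_treeSeries_pow,
        map_one]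
      exact ⟨coactionLin_tree .nil, rfl⟩
    have hδ : coactionLin (treeSum (n + 1)) = ∑ x ∈ antidiagonal (n + 1),
        treeSum x.1 ⊗ₜ PowerSeries.coeff x.2 (treeSeries ^ x.1) := by
      have h1 : ∀ x ∈ antidiagonal n, coactionLin (treeSum x.1 * linV (treeSum x.2)) =
          ∑ y ∈ antidiagonal x.1, ∑ z ∈ antidiagonal x.2,
            (treeSum y.1 * linV (treeSum z.1)) ⊗ₜ
              (PowerSeries.coeff y.2 (treeSeries ^ (y.1 + 1)) *
                PowerSeries.coeff z.2 (treeSeries ^ z.1)) := by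
        intro x hx
        rw [HasAntidiagonal.mem_antidiagonal] at hx
        rw [coactionLin_mul_linV, (ih x.1 (by omega)).2, (ih x.2 (by omega)).1, map_sum,
          sum_mul_sum]
        simp only [VTensorId_tmul, tmul_mul_tmul]
      rw [treeSum_succ, map_sum, sum_congr rfl h1, sum_antidiagonal_exchange n
        (fun k p l q => (treeSum k * linV (treeSum l)) ⊗ₜ[ℂ]
          (PowerSeries.coeff p (treeSeries ^ (k + 1)) *
            PowerSeries.coeff q (treeSeries ^ l))), Nat.sum_antidiagonal_succ]
      -- The term k = 0 vanishes, since T^0 has no coefficient of positive degree; the other terms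
      -- are shifted by the root vertex.
      rw [pow_zero, PowerSeries.coeff_one, if_neg n.succ_ne_zero, TensorProduct.tmul_zero,
        zero_add]
      refine sum_congr rfl fun x _ => ?_
      rw [treeSum_succ, TensorProduct.sum_tmul]
      refine sum_congr rfl fun y hy => ?_
      rw [HasAntidiagonal.mem_antidiagonal] at hy
      -- For t_k / V(t_l) the right factors T^{k+1} and T^l multiply to T^{k+l+1}, and k + l + 1 is
      -- the order of the trees on the left.
      rw [← TensorProduct.tmul_sum, ← PowerSeries.coeff_mul, ← pow_add, ← hy]
      congr 3
      omega
    refine ⟨hδ, ?_⟩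
    have h2 : comulHom (treeSum (n + 1)) = coactionLin (treeSum (n + 1)) +
        ∑ x ∈ antidiagonal n, ∑ y ∈ antidiagonal x.1,
          treeSum y.1 ⊗ₜ (PowerSeries.coeff y.2 (treeSeries ^ (y.1 + 1)) *
            linV (treeSum x.2)) := by
      rw [treeSum_succ, map_sum, map_sum, ← sum_add_distrib]
      refine sum_congr rfl fun x hx => ?_
      rw [HasAntidiagonal.mem_antidiagonal] at hx
      rw [map_mul, comulHom_linV, coactionLin_mul_linV, mul_add, add_comm]
      congr 1
      rw [(ih x.1 (by omega)).2, sum_mul]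
      refine sum_congr rfl fun y _ => ?_
      rw [tmul_mul_tmul, mul_one]
    -- The term k = n + 1 is split off on both sides: there T^k and T^{k+1} have the same constant
    -- coefficient 1.
    rw [h2, hδ, sum_antidiagonal_assoc n (fun k p j => treeSum k ⊗ₜ[ℂ]
      (PowerSeries.coeff p (treeSeries ^ (k + 1)) * linV (treeSum j))),
      Nat.sum_antidiagonal_succ', Nat.sum_antidiagonal_succ', coeff_zero_treeSeries_pow,
      coeff_zero_treeSeries_pow, add_assoc, ← sum_add_distrib]
    congr 1
    refine sum_congr rfl fun x _ => ?_
    rw [coeff_succ_treeSeries_pow_succ, TensorProduct.tmul_add, TensorProduct.tmul_sum]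

end TreeSums

/-! ### The embeddings of the series Hopf algebras -/

section Embeddings

open Finset Algebra.TensorProduct

/-- `Ω : ℂ(G^dif) → H^α`, `a_n ↦ t_n`. -/
def omegaHom : CGdif →ₐ[ℂ] Halpha := MvPolynomial.aeval fun n => toHalpha (treeSum (n + 1))

theorem omegaHom_a (n : ℕ) : omegaHom (a n) = toHalpha (treeSum n) := by
  cases n with
  | zero => rw [a, treeSum_zero, map_one, map_one]
  | succ n => rw [a, omegaHom, MvPolynomial.aeval_X]

/-- `j : H^inv → H^e`, `b_n ↦ t_n`. -/
def jHom : Hinv →ₐ[ℂ] He := FreeAlgebra.lift ℂ fun n => toHe (treeSum (n + 1))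

theorem toHe_one : toHe 1 = 1 := toHe_tree .nil

theorem jHom_b (n : ℕ) : jHom (b n) = toHe (treeSum n) := by
  cases n with
  | zero => rw [b, treeSum_zero, map_one, toHe_one]
  | succ n => rw [b, jHom, FreeAlgebra.lift_ι_apply]

/-! ### Compatibility of Ω and j with co-products, co-units and co-actions -/

theorem coeff_seriesA_pow (k p : ℕ) :
    PowerSeries.coeff (p + k) (seriesA ^ k) = PowerSeries.coeff p (PowerSeries.mk a ^ k) := by
  rw [seriesA, mul_pow, PowerSeries.coeff_X_pow_mul]

theorem coeff_self_seriesA_pow (k : ℕ) : PowerSeries.coeff k (seriesA ^ k) = 1 := by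
  have h := coeff_seriesA_pow k 0
  rw [zero_add] at h
  rw [h, PowerSeries.coeff_zero_eq_constantCoeff_apply, map_pow,
    ← PowerSeries.coeff_zero_eq_constantCoeff_apply, PowerSeries.coeff_mk, a, one_pow]

/-- Ω carries A(x) to x T(x) with coefficients in H^α, so A^k acquires the shift by k. -/
theorem omegaHom_coeff_seriesA_pow (k p : ℕ) :
    omegaHom (PowerSeries.coeff (p + k) (seriesA ^ k)) =
      toHalpha (PowerSeries.coeff p (treeSeries ^ k)) := by
  have h : PowerSeries.map (omegaHom : CGdif →+* Halpha) (PowerSeries.mk a) =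
      PowerSeries.map (toHalpha : TreeAlg →+* Halpha) treeSeries := by
    ext1 n
    rw [PowerSeries.coeff_map, PowerSeries.coeff_map, PowerSeries.coeff_mk, coeff_treeSeries]
    exact omegaHom_a n
  have h2 := congrArg (fun f => PowerSeries.coeff p (f ^ k)) h
  simp only [← map_pow, PowerSeries.coeff_map] at h2
  rw [coeff_seriesA_pow]
  exact h2

theorem alphaComul_comp_omegaHom :
    alphaComul.comp omegaHom = (map omegaHom omegaHom).comp difComul := by
  apply MvPolynomial.algHom_ext
  intro n
  rw [AlgHom.comp_apply, AlgHom.comp_apply, omegaHom, MvPolynomial.aeval_X, ← omegaHom,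
    alphaComul_toHalpha, (coactionLin_comulHom_treeSum (n + 1)).2, difComul,
    MvPolynomial.aeval_X, map_sum, map_sum, Nat.sum_antidiagonal_eq_sum_range_succ_mk]
  refine sum_congr rfl fun k hk => ?_
  rw [mem_range] at hk
  -- The generator with index n is a_{n+1}, so the coefficient of x^{n+2} in A^{k+1} corresponds to
  -- that of x^{n+1-k} in T^{k+1}.
  rw [map_tmul, map_tmul, omegaHom_a, show n + 2 = (n + 1 - k) + (k + 1) by omega,
    omegaHom_coeff_seriesA_pow]

theorem treeCounit_treeSum_succ (n : ℕ) : treeCounit (treeSum (n + 1)) = 0 := by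
  rw [treeSum, map_sum]
  refine sum_eq_zero fun t ht => ?_
  rw [treeCounit_tree, if_neg]
  rintro rfl
  rw [BinaryTree.mem_treesOfNumNodesEq] at ht
  simp [BinaryTree.numNodes] at ht

theorem alphaCounit_comp_omegaHom : alphaCounit.comp omegaHom = difCounit := by
  apply MvPolynomial.algHom_ext
  intro n
  rw [AlgHom.comp_apply, omegaHom, MvPolynomial.aeval_X, difCounit, MvPolynomial.aeval_X]
  exact treeCounit_treeSum_succ n

theorem invComul_b (n : ℕ) : invComul (b n) = ∑ k ∈ range (n + 1), b k ⊗ₜ b (n - k) := by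
  cases n with
  | zero => rw [b, map_one, zero_add, range_one, sum_singleton]; rfl
  | succ n => rw [b, invComul, FreeAlgebra.lift_ι_apply]

theorem difCoaction_b (n : ℕ) : difCoaction (b n) =
    ∑ k ∈ range (n + 1), b k ⊗ₜ PowerSeries.coeff n (seriesA ^ k) := by
  cases n with
  | zero =>
    rw [b, map_one, zero_add, range_one, sum_singleton, coeff_self_seriesA_pow]; rfl
  | succ n => rw [b, difCoaction, FreeAlgebra.lift_ι_apply]

theorem difComul_a (n : ℕ) : difComul (a n) =
    ∑ k ∈ range (n + 1), a k ⊗ₜ PowerSeries.coeff (n + 1) (seriesA ^ (k + 1)) := by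
  cases n with
  | zero =>
    rw [a, map_one, zero_add, range_one, sum_singleton, coeff_self_seriesA_pow]; rfl
  | succ n => rw [a, difComul, MvPolynomial.aeval_X]

theorem ι_eq_b (n : ℕ) : FreeAlgebra.ι ℂ n = b (n + 1) := rfl

theorem eComul_comp_jHom : eComul.comp jHom = (map jHom jHom).comp invComul := by
  apply FreeAlgebra.hom_ext
  funext n
  simp only [Function.comp_apply, AlgHom.comp_apply]
  rw [ι_eq_b, jHom_b, eComul_toHe, underLin_treeSum, invComul_b, map_sum, map_sum,
    Nat.sum_antidiagonal_eq_sum_range_succ_mk]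
  refine sum_congr rfl fun k _ => ?_
  rw [TensorProduct.map_tmul, map_tmul, jHom_b, jHom_b]

theorem eCounit_comp_jHom : eCounit.comp jHom = invCounit := by
  apply FreeAlgebra.hom_ext
  funext n
  simp only [Function.comp_apply, AlgHom.comp_apply]
  rw [ι_eq_b, jHom_b, eCounit_toHe, treeCounit_treeSum_succ, ← ι_eq_b, invCounit,
    FreeAlgebra.lift_ι_apply]

theorem eCoaction_comp_jHom : eCoaction.comp jHom = (map jHom omegaHom).comp difCoaction := by
  apply FreeAlgebra.hom_ext
  funext n
  simp only [Function.comp_apply, AlgHom.comp_apply]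
  rw [ι_eq_b, jHom_b, eCoaction_toHe, (coactionLin_comulHom_treeSum (n + 1)).1, difCoaction_b,
    map_sum, map_sum, Nat.sum_antidiagonal_eq_sum_range_succ_mk]
  refine sum_congr rfl fun k hk => ?_
  rw [mem_range] at hk
  have h := omegaHom_coeff_seriesA_pow k (n + 1 - k)
  rw [show n + 1 - k + k = n + 1 by omega] at h
  rw [TensorProduct.map_tmul, map_tmul, jHom_b, h, AlgHom.toLinearMap_apply]

/-! #### Left inverses -/

/-- The right comb with `n` internal vertices. -/
def comb : ℕ → PBT
  | 0 => .nil
  | n + 1 => V (comb n)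

theorem numNodes_comb (n : ℕ) : (comb n).numNodes = n := by
  induction n with
  | zero => rfl
  | succ n ih => simp [comb, V, BinaryTree.numNodes, ih]

/-- The value `f n` at the comb with `n` internal vertices, zero on the other trees. -/
def onCombs {M : Type*} [Zero M] (f : ℕ → M) (t : PBT) : M :=
  if t = comb t.numNodes then f t.numNodes else 0

theorem sum_onCombs {M : Type*} [AddCommMonoid M] (f : ℕ → M) (n : ℕ) :
    ∑ t ∈ BinaryTree.treesOfNumNodesEq n, onCombs f t = f n := by
  rw [sum_eq_single (comb n)]
  · rw [onCombs, numNodes_comb, if_pos rfl]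
  · intro t ht h
    rw [BinaryTree.mem_treesOfNumNodesEq] at ht
    rw [onCombs, ht, if_neg h]
  · intro h
    exact absurd (BinaryTree.mem_treesOfNumNodesEq.2 (numNodes_comb n)) h

/-- The polynomials `c_n` such that `a_{n+1} = ∑ a_i c_{n-i}`. -/
def primSeries : PowerSeries CGdif :=
  PowerSeries.invOfUnit (PowerSeries.mk a) 1 * PowerSeries.mk fun n => a (n + 1)

theorem a_succ (n : ℕ) :
    a (n + 1) = ∑ x ∈ antidiagonal n, a x.1 * PowerSeries.coeff x.2 primSeries := by
  have h : PowerSeries.mk a * primSeries = PowerSeries.mk fun n => a (n + 1) := by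
    rw [primSeries, ← mul_assoc, PowerSeries.mul_invOfUnit, one_mul]
    rw [← PowerSeries.coeff_zero_eq_constantCoeff_apply, PowerSeries.coeff_mk]
    rfl
  have h2 := congrArg (PowerSeries.coeff n) h
  rw [PowerSeries.coeff_mul, PowerSeries.coeff_mk] at h2
  simp only [PowerSeries.coeff_mk] at h2
  exact h2.symm

/-- A left inverse of `Ω`. -/
def omegaInv : Halpha →ₐ[ℂ] CGdif :=
  MvPolynomial.aeval (onCombs fun n => PowerSeries.coeff n primSeries)

/-- Exactly one tree of each order is a comb, so the image of V(t_n) is the coefficient c_n of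
`primSeries`; the recursion for t_{n+1} then becomes that for a_{n+1}. -/
theorem omegaInv_toHalpha_treeSum (n : ℕ) : omegaInv (toHalpha (treeSum n)) = a n := by
  induction n using Nat.strong_induction_on with
  | _ n ih =>
    rcases n with _ | n
    · rw [treeSum_zero, map_one, map_one, a]
    rw [treeSum_succ, map_sum, map_sum, a_succ]
    refine sum_congr rfl fun x hx => ?_
    rw [HasAntidiagonal.mem_antidiagonal] at hx
    rw [map_mul, map_mul, ih x.1 (by omega), treeSum, map_sum, map_sum, map_sum,
      ← sum_onCombs (fun n => PowerSeries.coeff n primSeries) x.2]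
    congr 1
    refine sum_congr rfl fun t _ => ?_
    rw [linV_tree, ← X_eq_toHalpha, omegaInv, MvPolynomial.aeval_X]

theorem omegaInv_comp_omegaHom : omegaInv.comp omegaHom = AlgHom.id ℂ CGdif := by
  apply MvPolynomial.algHom_ext
  intro n
  rw [AlgHom.comp_apply, omegaHom, MvPolynomial.aeval_X, omegaInv_toHalpha_treeSum]
  rfl

/-- A left inverse of `j`. -/
def jInv : He →ₐ[ℂ] Hinv := FreeAlgebra.lift ℂ fun t => onCombs b t.1

/-- All trees are free generators of H^e, so it suffices to send the comb of order n to b_n and the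
other trees to zero. -/
theorem jInv_comp_jHom : jInv.comp jHom = AlgHom.id ℂ Hinv := by
  apply FreeAlgebra.hom_ext
  funext n
  simp only [Function.comp_apply, AlgHom.comp_apply]
  rw [ι_eq_b, jHom_b, treeSum, map_sum, map_sum, AlgHom.id_apply, ← sum_onCombs b (n + 1)]
  refine sum_congr rfl fun t ht => ?_
  rw [BinaryTree.mem_treesOfNumNodesEq] at ht
  have h : t ≠ .nil := by
    rintro rfl
    simp [BinaryTree.numNodes] at ht
  rw [toHe_tree, treeGen_coe ⟨t, h⟩, jInv, FreeAlgebra.lift_ι_apply]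

end Embeddings

/-! ### Morphisms between semi-direct co-products -/

section SmashMap

open Algebra.TensorProduct

variable {H B H' B' : Type} [CommRing H] [Algebra ℂ H] [Ring B] [Algebra ℂ B]
  [CommRing H'] [Algebra ℂ H'] [Ring B'] [Algebra ℂ B']

theorem smashComul_comp_map {ΔH : H →ₐ[ℂ] H ⊗[ℂ] H} {ΔB : B →ₐ[ℂ] B ⊗[ℂ] B}
    {δ : B →ₐ[ℂ] B ⊗[ℂ] H} {ΔH' : H' →ₐ[ℂ] H' ⊗[ℂ] H'} {ΔB' : B' →ₐ[ℂ] B' ⊗[ℂ] B'}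
    {δ' : B' →ₐ[ℂ] B' ⊗[ℂ] H'} {f : H →ₐ[ℂ] H'} {g : B →ₐ[ℂ] B'}
    (hf : ΔH'.comp f = (map f f).comp ΔH) (hg : ΔB'.comp g = (map g g).comp ΔB)
    (hδ : δ'.comp g = (map g f).comp δ) :
    (smashComul ΔH' ΔB' δ').comp (map f g) =
      (map (map f g) (map f g)).comp (smashComul ΔH ΔB δ) := by
  apply Algebra.TensorProduct.ext'
  intro x y
  rw [AlgHom.comp_apply, AlgHom.comp_apply, map_tmul, smashComul_tmul, smashComul_tmul, map_mul]
  congr 1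
  · have h := DFunLike.congr_fun hf x
    simp only [AlgHom.comp_apply] at h
    rw [smashLeft, AlgHom.comp_apply, h, smashLeft, AlgHom.comp_apply]
    generalize ΔH x = w
    induction w with
    | zero => simp
    | add p q hp hq => simp only [map_add, hp, hq]
    | tmul u v => simp
  · have h := DFunLike.congr_fun hg y
    simp only [AlgHom.comp_apply] at h
    rw [smashRight_apply, smashRight_apply, h]
    generalize ΔB y = w
    induction w with
    | zero => simp
    | add p q hp hq => simp only [map_add, hp, hq]
    | tmul u v =>
      have h' := DFunLike.congr_fun hδ u
      simp only [AlgHom.comp_apply] at h'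
      rw [map_tmul, map_tmul, map_tmul, h']
      generalize δ u = z
      induction z with
      | zero => simp
      | add p q hp hq => simp only [map_add, TensorProduct.add_tmul, hp, hq]
      | tmul c d => simp [smashEmb_tmul]

theorem smashCounit_comp_map {εH : H →ₐ[ℂ] ℂ} {εB : B →ₐ[ℂ] ℂ} {εH' : H' →ₐ[ℂ] ℂ}
    {εB' : B' →ₐ[ℂ] ℂ} {f : H →ₐ[ℂ] H'} {g : B →ₐ[ℂ] B'} (hf : εH'.comp f = εH)
    (hg : εB'.comp g = εB) :
    (smashCounit εH' εB').comp (map f g) = smashCounit εH εB := by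
  apply Algebra.TensorProduct.ext'
  intro x y
  rw [AlgHom.comp_apply, map_tmul, smashCounit_tmul, smashCounit_tmul, ← hf, ← hg]
  rfl

end SmashMap

/-! ### Bialgebra axioms along an embedding -/

section Retract

open Algebra.TensorProduct

variable {A A' : Type} [Ring A] [Algebra ℂ A] [Ring A'] [Algebra ℂ A']
  {Δ : A →ₐ[ℂ] A ⊗[ℂ] A} {ε : A →ₐ[ℂ] ℂ} {Δ' : A' →ₐ[ℂ] A' ⊗[ℂ] A'} {ε' : A' →ₐ[ℂ] ℂ}
  {i : A →ₐ[ℂ] A'} {p : A' →ₐ[ℂ] A}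

/-- The identity holds after embedding in A' ⊗ A' ⊗ A', and this embedding is injective because p
gives it a left inverse; p need not respect co-products. -/
theorem coassoc_of_leftInverse (hp : p.comp i = AlgHom.id ℂ A)
    (hi : Δ'.comp i = (map i i).comp Δ)
    (h : (Algebra.TensorProduct.assoc ℂ ℂ ℂ A' A' A').toAlgHom.comp
      ((map Δ' (AlgHom.id ℂ A')).comp Δ') = (map (AlgHom.id ℂ A') Δ').comp Δ') :
    (Algebra.TensorProduct.assoc ℂ ℂ ℂ A A A).toAlgHom.comp
      ((map Δ (AlgHom.id ℂ A)).comp Δ) = (map (AlgHom.id ℂ A) Δ).comp Δ := by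
  have hinj : Injective (map i (map i i)) := by
    refine LeftInverse.injective (g := map p (map p p)) fun x => ?_
    rw [← AlgHom.comp_apply, ← map_comp, ← map_comp, hp, map_id, map_id, AlgHom.id_apply]
  have hi' : ∀ x, Δ' (i x) = map i i (Δ x) := fun x => DFunLike.congr_fun hi x
  have h1 : ∀ w : A ⊗[ℂ] A, map i (map i i) (Algebra.TensorProduct.assoc ℂ ℂ ℂ A A A
      (map Δ (AlgHom.id ℂ A) w)) = Algebra.TensorProduct.assoc ℂ ℂ ℂ A' A' A'
        (map Δ' (AlgHom.id ℂ A') (map i i w)) := by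
    intro w
    induction w with
    | zero => simp
    | add p q hp hq => simp only [map_add, hp, hq]
    | tmul u v =>
      rw [map_tmul, map_tmul, map_tmul, hi']
      generalize Δ u = z
      induction z with
      | zero => simp
      | add p q hp hq => simp only [map_add, TensorProduct.add_tmul, hp, hq]
      | tmul c d => rfl
  have h2 : ∀ w : A ⊗[ℂ] A, map i (map i i) (map (AlgHom.id ℂ A) Δ w) =
      map (AlgHom.id ℂ A') Δ' (map i i w) := by
    intro w
    induction w with
    | zero => simp
    | add p q hp hq => simp only [map_add, hp, hq]
    | tmul u v =>
      rw [map_tmul, map_tmul, map_tmul, map_tmul, hi']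
      rfl
  ext x
  apply hinj
  have := DFunLike.congr_fun h (i x)
  simp only [AlgHom.comp_apply] at this ⊢
  rw [h2, ← hi', ← this, hi']
  exact h1 _

theorem rTensor_of_leftInverse (hp : p.comp i = AlgHom.id ℂ A)
    (hi : Δ'.comp i = (map i i).comp Δ) (hε : ε'.comp i = ε)
    (h : (map ε' (AlgHom.id ℂ A')).comp Δ' = (Algebra.TensorProduct.lid ℂ A').symm) :
    (map ε (AlgHom.id ℂ A)).comp Δ = (Algebra.TensorProduct.lid ℂ A).symm := by
  ext x
  have h1 := congrArg (map (AlgHom.id ℂ ℂ) p) (DFunLike.congr_fun h (i x))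
  have h2 := DFunLike.congr_fun hi x
  simp only [AlgHom.comp_apply] at h1 h2 ⊢
  rw [h2, ← AlgHom.comp_apply (map ε' _), ← map_comp, ← AlgHom.comp_apply, ← map_comp, hε,
    AlgHom.id_comp, AlgHom.id_comp, hp] at h1
  rw [h1]
  change (1 : ℂ) ⊗ₜ[ℂ] (p.comp i) x = 1 ⊗ₜ x
  rw [hp]
  rfl

theorem lTensor_of_leftInverse (hp : p.comp i = AlgHom.id ℂ A)
    (hi : Δ'.comp i = (map i i).comp Δ) (hε : ε'.comp i = ε)
    (h : (map (AlgHom.id ℂ A') ε').comp Δ' = (Algebra.TensorProduct.rid ℂ ℂ A').symm) :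
    (map (AlgHom.id ℂ A) ε).comp Δ = (Algebra.TensorProduct.rid ℂ ℂ A).symm := by
  ext x
  have h1 := congrArg (map p (AlgHom.id ℂ ℂ)) (DFunLike.congr_fun h (i x))
  have h2 := DFunLike.congr_fun hi x
  simp only [AlgHom.comp_apply] at h1 h2 ⊢
  rw [h2, ← AlgHom.comp_apply (map _ ε'), ← map_comp, ← AlgHom.comp_apply, ← map_comp, hε,
    AlgHom.id_comp, AlgHom.id_comp, hp] at h1
  rw [h1]
  change (p.comp i) x ⊗ₜ[ℂ] (1 : ℂ) = x ⊗ₜ 1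
  rw [hp]
  rfl

end Retract

/-! ### The Hopf algebra `ℂ(G^dif) ⋉ H^inv` -/

section Series

open Finset Algebra.TensorProduct

/-- `Ω ⊗ j`. -/
def seriesToQED : SeriesSmash →ₐ[ℂ] QEDSmash := map omegaHom jHom

theorem qedComul_comp_seriesToQED :
    qedComul.comp seriesToQED = (map seriesToQED seriesToQED).comp seriesComul :=
  smashComul_comp_map alphaComul_comp_omegaHom eComul_comp_jHom eCoaction_comp_jHom

theorem qedCounit_comp_seriesToQED : qedCounit.comp seriesToQED = seriesCounit :=
  smashCounit_comp_map alphaCounit_comp_omegaHom eCounit_comp_jHom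

theorem comp_seriesToQED : (map omegaInv jInv).comp seriesToQED = AlgHom.id ℂ SeriesSmash := by
  rw [seriesToQED, ← map_comp, omegaInv_comp_omegaHom, jInv_comp_jHom, map_id]

/-- In Δ a_n and δ b_n the last term, k = n, has right factor 1 because A^k starts with x^k. All
other left factors of Δ(a_n ⊗ 1) and Δ(1 ⊗ b_n) have smaller index. -/
theorem series_conil (C : Subalgebra ℂ SeriesSmash)
    (hC : ∀ x, ∀ z ∈ LinearMap.range (C.toSubmodule.subtype.rTensor SeriesSmash),
      seriesComul x = x ⊗ₜ[ℂ] 1 + z → x ∈ C) : C = ⊤ := by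
  have hl : ∀ n, a n ⊗ₜ[ℂ] (1 : Hinv) ∈ C := by
    intro n
    induction n using Nat.strong_induction_on with
    | _ n ih =>
      refine hC _ (∑ k ∈ range n, (a k ⊗ₜ 1) ⊗ₜ
        (PowerSeries.coeff (n + 1) (seriesA ^ (k + 1)) ⊗ₜ 1)) (sum_mem fun k hk => ?_) ?_
      · exact tmul_mem_range_rTensor (P := C.toSubmodule) (ih k (mem_range.1 hk)) _
      · rw [seriesComul, smashComul_tmul_one, smashLeft, AlgHom.comp_apply, difComul_a,
          sum_range_succ, coeff_self_seriesA_pow, map_add, map_sum, add_comm]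
        rfl
  have hr : ∀ n, (1 : CGdif) ⊗ₜ[ℂ] b n ∈ C := by
    intro n
    induction n using Nat.strong_induction_on with
    | _ n ih =>
      have hEmb : ∀ (k : ℕ) (y : Hinv), smashEmb CGdif Hinv (difCoaction (b k) ⊗ₜ y) =
          ∑ l ∈ range (k + 1), (1 ⊗ₜ b l) ⊗ₜ (PowerSeries.coeff k (seriesA ^ l) ⊗ₜ y) := by
        intro k y
        rw [difCoaction_b, TensorProduct.sum_tmul, map_sum]
        rfl
      -- The first sum is δ(b_n) ⊗ 1 without its leading term; the second collects δ(b_k) ⊗ b_{n-k}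
      -- for k < n.
      refine hC _ ((∑ l ∈ range n, (1 ⊗ₜ b l) ⊗ₜ (PowerSeries.coeff n (seriesA ^ l) ⊗ₜ 1)) +
        ∑ k ∈ range n, ∑ l ∈ range (k + 1),
          (1 ⊗ₜ b l) ⊗ₜ (PowerSeries.coeff k (seriesA ^ l) ⊗ₜ b (n - k)))
        (add_mem (sum_mem fun l hl => ?_) (sum_mem fun k hk => sum_mem fun l hl => ?_)) ?_
      · exact tmul_mem_range_rTensor (P := C.toSubmodule) (ih l (mem_range.1 hl)) _
      · rw [mem_range] at hk hl
        exact tmul_mem_range_rTensor (P := C.toSubmodule) (ih l (by omega)) _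
      · rw [seriesComul, smashComul_one_tmul, smashRight_apply, invComul_b, sum_range_succ,
          map_add, map_add, map_sum, map_sum, Nat.sub_self, map_tmul, b, AlgHom.id_apply, hEmb,
          sum_range_succ, coeff_self_seriesA_pow, add_comm, add_comm (∑ x ∈ range n, _),
          add_assoc]
        congr 2
        refine sum_congr rfl fun k _ => ?_
        rw [map_tmul, AlgHom.id_apply, hEmb]
  exact subalgebra_tensor_eq_top (fun n => hl (n + 1)) fun n => hr (n + 1)

theorem isHopf_series : IsHopf seriesComul seriesCounit :=
  IsHopf.of_adjoin
    (coassoc_of_leftInverse comp_seriesToQED qedComul_comp_seriesToQED isHopf_qed.coassoc)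
    (rTensor_of_leftInverse comp_seriesToQED qedComul_comp_seriesToQED
      qedCounit_comp_seriesToQED isHopf_qed.rTensor)
    (lTensor_of_leftInverse comp_seriesToQED qedComul_comp_seriesToQED
      qedCounit_comp_seriesToQED isHopf_qed.lTensor)
    series_conil

end Series

end QEDHopf

end

theorem corollary4p3 :
    ∃ (Ω : QEDHopf.CGdif →ₐ[ℂ] QEDHopf.Halpha) (j : QEDHopf.Hinv →ₐ[ℂ] QEDHopf.He),
      -- the embeddings of the two factors, which respect co-products and co-units
      (∀ n : ℕ, Ω (QEDHopf.a n) = QEDHopf.toHalpha (QEDHopf.treeSum n)) ∧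
      (∀ n : ℕ, j (QEDHopf.b n) = QEDHopf.toHe (QEDHopf.treeSum n)) ∧
      Function.Injective Ω ∧ Function.Injective j ∧
      QEDHopf.alphaComul.comp Ω = (Algebra.TensorProduct.map Ω Ω).comp QEDHopf.difComul ∧
      QEDHopf.alphaCounit.comp Ω = QEDHopf.difCounit ∧
      QEDHopf.eComul.comp j = (Algebra.TensorProduct.map j j).comp QEDHopf.invComul ∧
      QEDHopf.eCounit.comp j = QEDHopf.invCounit ∧
      -- they are compatible with the co-actions
      QEDHopf.eCoaction.comp j = (Algebra.TensorProduct.map j Ω).comp QEDHopf.difCoaction ∧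
      -- the two semi-direct co-products are Hopf algebras, and `Ω ⊗ j` embeds one in the other
      ∃ (hser : QEDHopf.IsHopf QEDHopf.seriesComul QEDHopf.seriesCounit)
        (hqed : QEDHopf.IsHopf QEDHopf.qedComul QEDHopf.qedCounit),
        letI : HopfAlgebra ℂ QEDHopf.SeriesSmash := hser.hopfAlgebra
        letI : HopfAlgebra ℂ QEDHopf.QEDSmash := hqed.hopfAlgebra
        ∃ Φ : QEDHopf.SeriesSmash →ₐc[ℂ] QEDHopf.QEDSmash,
          (∀ (x : QEDHopf.CGdif) (y : QEDHopf.Hinv), Φ (x ⊗ₜ[ℂ] y) = Ω x ⊗ₜ[ℂ] j y) ∧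
          Function.Injective Φ ∧
          ∀ x : QEDHopf.SeriesSmash,
            Φ (HopfAlgebra.antipode ℂ x) = HopfAlgebra.antipode ℂ (Φ x) := by
  refine ⟨QEDHopf.omegaHom, QEDHopf.jHom, QEDHopf.omegaHom_a, QEDHopf.jHom_b,
    LeftInverse.injective (g := QEDHopf.omegaInv)
      (DFunLike.congr_fun QEDHopf.omegaInv_comp_omegaHom),
    LeftInverse.injective (g := QEDHopf.jInv)
      (DFunLike.congr_fun QEDHopf.jInv_comp_jHom),
    QEDHopf.alphaComul_comp_omegaHom, QEDHopf.alphaCounit_comp_omegaHom,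
    QEDHopf.eComul_comp_jHom, QEDHopf.eCounit_comp_jHom, QEDHopf.eCoaction_comp_jHom,
    QEDHopf.isHopf_series, QEDHopf.isHopf_qed, ?_⟩
  let : HopfAlgebra ℂ QEDHopf.SeriesSmash := QEDHopf.isHopf_series.hopfAlgebra
  let : HopfAlgebra ℂ QEDHopf.QEDSmash := QEDHopf.isHopf_qed.hopfAlgebra
  let Φ : QEDHopf.SeriesSmash →ₐc[ℂ] QEDHopf.QEDSmash :=
    BialgHom.ofAlgHom QEDHopf.seriesToQED QEDHopf.qedCounit_comp_seriesToQED
      QEDHopf.qedComul_comp_seriesToQED.symm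
  exact ⟨Φ, fun _ _ => rfl,
    LeftInverse.injective (g := Algebra.TensorProduct.map QEDHopf.omegaInv QEDHopf.jInv)
      (DFunLike.congr_fun QEDHopf.comp_seriesToQED),
    QEDHopf.bialgHom_antipode Φ⟩
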